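/- **Theorem 2.** Let \(N\in\{1,2,\dots\}\), \(\alpha\in(0,N)\), \(p\in(1,\infty)\), and let \[ I_\alpha(x)=\frac{\Gamma(\frac{N-\alpha}{2})}{\Gamma(\frac{\alpha}{2})\,\pi^{N/2}\,2^{\alpha}\,|x|^{N-\alpha}} \qquad (x\in\mathbb R^N\setminus\{0\}) \] be the Riesz potential. Let \(u\in W^{1,2}(\mathbb R^N)\cap L^{\frac{2Np}{N+\alpha}}(\mathbb R^N)\) be real-valued, with weak gradient \(\nabla u\in W^{1,2}_{\mathrm{loc}}(\mathbb R^N)\cap L^{\frac{2Np}{N+\alpha}}_{\mathrm{loc}}(\mathbb R^N)\). Assume that \[ \frac1p\le\frac{N-2}{N+\alpha}\qquad\text{or}\qquad \frac1p\ge\frac{N}{N+\alpha}, \] and that \(u\) is a weak solution of the Choquard equation \[ -\Delta u+u=(I_\alpha*|u|^p)\,|u|^{p-2}u\quad\text{in }\mathbb R^N , \] that is, \(\int_{\mathbb R^N}\nabla u\cdot\nabla\varphi+\int_{\mathbb R^N}u\varphi=\int_{\mathbb R^N}(I_\alpha*|u|^p)|u|^{p-2}u\,\varphi\) for every \(\varphi\in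 C_c^\infty(\mathbb R^N)\). Then \(u=0\) almost everywhere. -/

import Mathlib

namespace Choquard

open MeasureTheory
open scoped ContDiff Convolution

noncomputable section

/-- `g ∈ L^q_loc(ℝ^N)`: `g` belongs to `L^q(K)` for every compact set `K`. -/
def MemLpLoc {N : ℕ} {F : Type*} [NormedAddCommGroup F]
    (g : EuclideanSpace ℝ (Fin N) → F) (q : ENNReal) : Prop :=
  ∀ K : Set (EuclideanSpace ℝ (Fin N)), IsCompact K → MemLp g q (volume.restrict K)

/-- `G` is the weak gradient of `u` on `ℝ^N`: both are locally integrable and, for every `i` and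
every `φ ∈ C_c^∞(ℝ^N)`, `∫ u ∂ᵢφ = - ∫ Gᵢ φ`. It is unique up to equality almost everywhere. -/
def HasWeakGradient {N : ℕ} (u : EuclideanSpace ℝ (Fin N) → ℝ)
    (G : EuclideanSpace ℝ (Fin N) → EuclideanSpace ℝ (Fin N)) : Prop :=
  LocallyIntegrable u ∧ LocallyIntegrable G ∧
    ∀ (i : Fin N) (φ : EuclideanSpace ℝ (Fin N) → ℝ), ContDiff ℝ ∞ φ → HasCompactSupport φ →
      ∫ x, u x * fderiv ℝ φ x (EuclideanSpace.single i 1) = - ∫ x, G x i * φ x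

/-- `u ∈ W^{1,2}(ℝ^N)`. -/
def MemW12 {N : ℕ} (u : EuclideanSpace ℝ (Fin N) → ℝ) : Prop :=
  MemLp u 2 ∧ ∃ G : EuclideanSpace ℝ (Fin N) → EuclideanSpace ℝ (Fin N),
    HasWeakGradient u G ∧ MemLp G 2

/-- `u ∈ W^{1,2}_loc(ℝ^N)`. -/
def MemW12Loc {N : ℕ} (u : EuclideanSpace ℝ (Fin N) → ℝ) : Prop :=
  MemLpLoc u 2 ∧ ∃ G : EuclideanSpace ℝ (Fin N) → EuclideanSpace ℝ (Fin N),
    HasWeakGradient u G ∧ MemLpLoc G 2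

/-- The Riesz potential `I_α` on `ℝ^N`. -/
def rieszPotential (N : ℕ) (α : ℝ) (x : EuclideanSpace ℝ (Fin N)) : ℝ :=
  Real.Gamma (((N : ℝ) - α) / 2) /
    (Real.Gamma (α / 2) * Real.pi ^ ((N : ℝ) / 2) * (2 : ℝ) ^ α * ‖x‖ ^ ((N : ℝ) - α))

/-- The nonlinearity `(I_α ∗ |u|^p) |u|^(p-2) u`. -/
def choquardTerm {N : ℕ} (α p : ℝ) (u : EuclideanSpace ℝ (Fin N) → ℝ)
    (x : EuclideanSpace ℝ (Fin N)) : ℝ :=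
  (rieszPotential N α ⋆[ContinuousLinearMap.mul ℝ ℝ, volume] fun y => |u y| ^ p) x *
    (|u x| ^ (p - 2) * u x)

/-- `-Δu + u = (I_α ∗ |u|^p) |u|^(p-2) u` weakly in `ℝ^N`: `u` has a weak gradient `G` and, for
every `φ ∈ C_c^∞(ℝ^N)`, `∫ G · ∇φ + ∫ u φ = ∫ (I_α ∗ |u|^p) |u|^(p-2) u φ`.
For `u ∈ W^{1,2} ∩ L^(2Np/(N+α))` with `0 < α < N` and `p > 1`, all three integrals converge
absolutely, by Cauchy-Schwarz and by the Hardy-Littlewood-Sobolev inequality. -/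
def IsWeakSolution {N : ℕ} (α p : ℝ) (u : EuclideanSpace ℝ (Fin N) → ℝ) : Prop :=
  ∃ G : EuclideanSpace ℝ (Fin N) → EuclideanSpace ℝ (Fin N), HasWeakGradient u G ∧
    ∀ φ : EuclideanSpace ℝ (Fin N) → ℝ, ContDiff ℝ ∞ φ → HasCompactSupport φ →
      (∫ x, inner ℝ (G x) (gradient φ x)) + ∫ x, u x * φ x = ∫ x, choquardTerm α p u x * φ x

end

end Choquard

namespace Choquard

open MeasureTheory Set Filter Topology
open scoped ENNReal ContDiff Convolution

/-! ### Finiteness of the Riesz energy (Hardy–Littlewood–Sobolev on the diagonal) -/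

section HLS

variable {N : ℕ}

/-! Put A = ∫|∇u|², B = ∫u², and let D be the double integral of I_α(x - y)|u(x)|^p|u(y)|^p. Two
identities decide everything. Testing the equation with u gives A + B = D (`nehari`). Testing it
with x·∇u, the generator of dilations, gives p((N-2)A + NB) = (N+α)D (`pohozaev`). Eliminating D
leaves (p(N-2) - (N+α))A + (pN - (N+α))B = 0. In the first range of p the coefficient of A is
nonnegative and that of B is positive, so B = 0. In the second range the coefficient of B is
nonpositive and that of A is negative, so A = 0, and a square-integrable function with zero weak
gradient vanishes. The sign of D plays no role.

The work lies in justifying the two tests, since neither u nor x·∇u is a smooth compactly supported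
function. Write r = 2N/(N+α) and q = rp. `integral_test` extends the equation by mollification to
compactly supported v in W^{1,2} ∩ L^q; domination of the nonlocal term comes from
`integrable_prod_kernel_mul`, because |u|^p and |u|^{p-2}uv lie in L^r. Only finiteness is needed
there, not a norm inequality.

For Pohozaev the test function is ξ ∂ᵢu, one direction at a time. The hypothesis ∇u ∈ W^{1,2}_loc
puts its gradient in L², and ∇u ∈ L^q_loc puts the function itself in L^q. The local terms become
divergences. In the nonlocal term, |u|^{p-2}u ∂ᵢu is the derivative of |u|^p/p, and integrating by
parts hits the singular kernel; symmetrising in x and y replaces ξ(x) by (ξ(x) - ξ(y))/2 and cancels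
the extra singularity (`integral_regKernel_mul_gradient`, then `integral_riesz_mul_gradient` removes
the regularisation). Finally ξ is replaced by t⁻¹ξ(t·) with ξ equal to xᵢ near 0. As t → 0 these
tend to xᵢ with uniformly bounded gradients, so dominated convergence gives one identity per
direction, and summing over i gives Pohozaev. -/

lemma lintegral_eq_mul_lintegral_comp_smul (g : EuclideanSpace ℝ (Fin N) → ℝ≥0∞)
    (hg : Measurable g) {R : ℝ} (hR : 0 < R) :
    ∫⁻ x, g x = ENNReal.ofReal (R ^ (N : ℝ)) * ∫⁻ x, g (R • x) := by
  have h := Measure.map_addHaar_smul (volume : Measure (EuclideanSpace ℝ (Fin N))) hR.ne'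
  have h2 : ∫⁻ x, g (R • x) = ∫⁻ x, g x ∂(Measure.map (R • ·) volume) :=
    (lintegral_map hg (measurable_const_smul R)).symm
  rw [h2, h, lintegral_smul_measure, smul_eq_mul, ← mul_assoc, ← ENNReal.ofReal_mul (by positivity)]
  have : R ^ (N : ℝ) * |(R ^ Module.finrank ℝ (EuclideanSpace ℝ (Fin N)))⁻¹| = 1 := by
    rw [abs_of_pos (by positivity), finrank_euclideanSpace_fin, Real.rpow_natCast]
    exact mul_inv_cancel₀ (by positivity)
  rw [this]; simp

lemma lintegral_ball_norm_rpow_lt_top (hN : 1 ≤ N) {s : ℝ} (hs : -(N : ℝ) < s) :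
    ∫⁻ z : EuclideanSpace ℝ (Fin N), (Metric.ball 0 1).indicator
      (fun z => ENNReal.ofReal (‖z‖ ^ s)) z < ⊤ := by
  have : Nonempty (Fin N) := ⟨⟨0, hN⟩⟩
  rw [lintegral_indicator Metric.isOpen_ball.measurableSet]
  have h : IntegrableOn (fun z : EuclideanSpace ℝ (Fin N) => ‖z‖ ^ s) (Metric.ball 0 1) := by
    rw [integrableOn_fun_norm_addHaar volume (f := fun t => t ^ s), finrank_euclideanSpace_fin]
    have h1 : IntegrableOn (fun y : ℝ => y ^ (s + (N - 1 : ℝ))) (Ioo 0 1) := by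
      have := intervalIntegral.intervalIntegrable_rpow' (a := 0) (b := 1)
        (show -1 < s + (N - 1 : ℝ) by linarith)
      exact ((intervalIntegrable_iff_integrableOn_Ioc_of_le zero_le_one).1 this).mono_set
        Ioo_subset_Ioc_self
    refine h1.congr_fun (fun y hy => ?_) measurableSet_Ioo
    have hy : 0 < y := hy.1
    simp only [smul_eq_mul]
    rw [Real.rpow_add hy, mul_comm, ← Real.rpow_natCast, Nat.cast_sub hN, Nat.cast_one]
  exact h.lintegral_lt_top

lemma lintegral_compl_ball_norm_rpow_lt_top {s : ℝ} (hs : s < -(N : ℝ)) :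
    ∫⁻ z : EuclideanSpace ℝ (Fin N), (Metric.ball 0 1)ᶜ.indicator
      (fun z => ENNReal.ofReal (‖z‖ ^ s)) z < ⊤ := by
  have h := integrable_one_add_norm (E := EuclideanSpace ℝ (Fin N)) (μ := volume) (r := -s)
    (by rw [finrank_euclideanSpace_fin]; linarith)
  have h2 := (h.const_mul ((2 : ℝ) ^ (-s))).lintegral_lt_top
  refine lt_of_le_of_lt (lintegral_mono fun z => ?_) h2
  by_cases hz : z ∈ (Metric.ball (0 : EuclideanSpace ℝ (Fin N)) 1)ᶜ
  · rw [indicator_of_mem hz]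
    apply ENNReal.ofReal_le_ofReal
    have hz : 1 ≤ ‖z‖ := by simpa using hz
    rw [neg_neg, Real.rpow_neg (by norm_num), ← div_eq_inv_mul, ← Real.div_rpow (by positivity) (by norm_num)]
    apply Real.rpow_le_rpow_of_nonpos (by positivity) (by linarith)
    · have : (0:ℝ) ≤ N := by positivity
      linarith
  · rw [indicator_of_notMem hz]; exact zero_le

variable {α : ℝ}

/-- Split the kernel at a radius R. Inside, the bound h ≤ a and local integrability of the kernel
give a multiple of a R^α. Outside, Hölder with the conjugate exponent r' = 2N/(N-α) turns the kernel
into |z|^{-2N}, integrable at infinity, and gives a multiple of R^{-N/r'}. -/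
lemma setLIntegral_level_mul_kernel_le (hN : 1 ≤ N) (hα : 0 < α) (hαN : α < N)
    {h : EuclideanSpace ℝ (Fin N) → ℝ} (hm : Measurable h)
    (hfin : ∫⁻ x, ENNReal.ofReal (h x) ^ (2 * N / (N + α)) < ⊤) :
    ∃ C : ℝ≥0∞, C < ⊤ ∧ ∀ x : EuclideanSpace ℝ (Fin N), ∀ a : ℝ, 0 < a →
      ∫⁻ y, {y | h y ≤ a}.indicator
        (fun y => ENNReal.ofReal (h y) * ENNReal.ofReal (‖x - y‖ ^ (-((N : ℝ) - α)))) y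
      ≤ C * ENNReal.ofReal (a ^ (((N : ℝ) - α) / (N + α))) := by
  have hN0 : (0 : ℝ) < N := by exact_mod_cast hN
  have hNa : (0 : ℝ) < N + α := by linarith
  have hNm : (0 : ℝ) < N - α := by linarith
  set r : ℝ := 2 * N / (N + α) with hr
  set r' : ℝ := 2 * N / (N - α) with hr'
  have hr0 : 0 < r := by positivity
  have hr'0 : 0 < r' := by positivity
  have hconj : r.HolderConjugate r' := by
    refine Real.holderConjugate_iff.2 ⟨?_, ?_⟩
    · rw [hr, lt_div_iff₀ hNa]; linarith
    · rw [hr, hr']; field_simp; ring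
  set J₁ := ∫⁻ z : EuclideanSpace ℝ (Fin N), (Metric.ball 0 1).indicator
      (fun z => ENNReal.ofReal (‖z‖ ^ (-((N : ℝ) - α)))) z with hJ1
  set J₂ := ∫⁻ z : EuclideanSpace ℝ (Fin N), (Metric.ball 0 1)ᶜ.indicator
      (fun z => ENNReal.ofReal (‖z‖ ^ (-(2 * N : ℝ)))) z with hJ2
  have hJ1t : J₁ < ⊤ := lintegral_ball_norm_rpow_lt_top hN (by linarith)
  have hJ2t : J₂ < ⊤ := lintegral_compl_ball_norm_rpow_lt_top (by linarith)
  set K := (∫⁻ x, ENNReal.ofReal (h x) ^ r) ^ (1 / r) with hK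
  have hKt : K < ⊤ := ENNReal.rpow_lt_top_of_nonneg (by positivity) hfin.ne
  have hJ2' : J₂ ^ (1 / r') < ⊤ := ENNReal.rpow_lt_top_of_nonneg (by positivity) hJ2t.ne
  refine ⟨J₁ + K * J₂ ^ (1 / r'), ENNReal.add_lt_top.2 ⟨hJ1t, ENNReal.mul_lt_top hKt hJ2'⟩, ?_⟩
  intro x a ha
  -- This radius balances the two contributions: a R^α and R^{-N/r'} both equal a^{(N-α)/(N+α)}.
  set R : ℝ := a ^ (-(2 / (N + α))) with hR
  have hR0 : 0 < R := by positivity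
  set k : EuclideanSpace ℝ (Fin N) → ℝ≥0∞ := fun z => ENNReal.ofReal (‖z‖ ^ (-((N : ℝ) - α)))
    with hk
  have hkm : Measurable k := by fun_prop
  have hin : ∫⁻ z, (Metric.ball 0 R).indicator k z = ENNReal.ofReal (R ^ α) * J₁ := by
    rw [lintegral_eq_mul_lintegral_comp_smul _ (hkm.indicator measurableSet_ball) hR0, hJ1]
    have : ∀ z : EuclideanSpace ℝ (Fin N), (Metric.ball 0 R).indicator k (R • z) =
        ENNReal.ofReal (R ^ (-((N : ℝ) - α))) * (Metric.ball 0 1).indicator k z := by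
      intro z
      have hiff : R • z ∈ Metric.ball (0 : EuclideanSpace ℝ (Fin N)) R ↔
          z ∈ Metric.ball (0 : EuclideanSpace ℝ (Fin N)) 1 := by
        simp only [mem_ball_zero_iff, norm_smul, Real.norm_of_nonneg hR0.le]
        exact ⟨fun h => by nlinarith, fun h => by nlinarith⟩
      by_cases hz : z ∈ Metric.ball (0 : EuclideanSpace ℝ (Fin N)) 1
      · rw [indicator_of_mem (hiff.2 hz), indicator_of_mem hz, hk]
        simp only [norm_smul, Real.norm_of_nonneg hR0.le]
        rw [Real.mul_rpow hR0.le (norm_nonneg _), ENNReal.ofReal_mul (by positivity)]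
      · rw [indicator_of_notMem (fun h => hz (hiff.1 h)), indicator_of_notMem hz, mul_zero]
    simp_rw [this]
    rw [lintegral_const_mul' _ _ ENNReal.ofReal_ne_top, ← mul_assoc,
      ← ENNReal.ofReal_mul (by positivity), ← Real.rpow_add hR0]
    congr 3; ring
  have hout : ∫⁻ z, ((Metric.ball 0 R)ᶜ.indicator k z) ^ r' =
      ENNReal.ofReal (R ^ (-(N : ℝ))) * J₂ := by
    have hm2 : Measurable fun z => ((Metric.ball 0 R)ᶜ.indicator k z) ^ r' :=
      (hkm.indicator measurableSet_ball.compl).pow_const _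
    rw [lintegral_eq_mul_lintegral_comp_smul _ hm2 hR0, hJ2]
    have : ∀ z : EuclideanSpace ℝ (Fin N), ((Metric.ball 0 R)ᶜ.indicator k (R • z)) ^ r' =
        ENNReal.ofReal (R ^ (-(2 * N : ℝ))) *
          (Metric.ball 0 1)ᶜ.indicator (fun z => ENNReal.ofReal (‖z‖ ^ (-(2 * N : ℝ)))) z := by
      intro z
      have hiff : R • z ∈ (Metric.ball (0 : EuclideanSpace ℝ (Fin N)) R)ᶜ ↔
          z ∈ (Metric.ball (0 : EuclideanSpace ℝ (Fin N)) 1)ᶜ := by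
        simp only [mem_compl_iff, mem_ball_zero_iff, norm_smul, Real.norm_of_nonneg hR0.le, not_lt]
        exact ⟨fun h => by nlinarith, fun h => by nlinarith⟩
      by_cases hz : z ∈ (Metric.ball (0 : EuclideanSpace ℝ (Fin N)) 1)ᶜ
      · rw [indicator_of_mem (hiff.2 hz), indicator_of_mem hz, hk]
        simp only [norm_smul, Real.norm_of_nonneg hR0.le]
        rw [ENNReal.ofReal_rpow_of_nonneg (by positivity) hr'0.le, ← Real.rpow_mul (by positivity),
          ← ENNReal.ofReal_mul (by positivity), ← Real.mul_rpow hR0.le (norm_nonneg _)]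
        congr 2
        rw [hr']; field_simp
      · rw [indicator_of_notMem (fun h => hz (hiff.1 h)), indicator_of_notMem hz, mul_zero,
          ENNReal.zero_rpow_of_pos hr'0]
    simp_rw [this]
    rw [lintegral_const_mul' _ _ ENNReal.ofReal_ne_top, ← mul_assoc,
      ← ENNReal.ofReal_mul (by positivity), ← Real.rpow_add hR0]
    congr 3; ring
  have hpt : ∀ y, {y | h y ≤ a}.indicator (fun y => ENNReal.ofReal (h y) * k (x - y)) y ≤
      ENNReal.ofReal a * (Metric.ball 0 R).indicator k (x - y) +
        ENNReal.ofReal (h y) * (Metric.ball 0 R)ᶜ.indicator k (x - y) := by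
    intro y
    by_cases hy : y ∈ {y | h y ≤ a}
    · rw [indicator_of_mem hy]
      by_cases hz : x - y ∈ Metric.ball (0 : EuclideanSpace ℝ (Fin N)) R
      · rw [indicator_of_mem hz, indicator_of_notMem (by simpa using hz), mul_zero, add_zero]
        gcongr
        exact hy
      · rw [indicator_of_notMem hz, indicator_of_mem (by simpa using hz), mul_zero, zero_add]
    · rw [indicator_of_notMem hy]; exact zero_le
  calc _ ≤ ∫⁻ y, (ENNReal.ofReal a * (Metric.ball 0 R).indicator k (x - y) +
        ENNReal.ofReal (h y) * (Metric.ball 0 R)ᶜ.indicator k (x - y)) := lintegral_mono hpt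
    _ = (ENNReal.ofReal a * ∫⁻ y, (Metric.ball 0 R).indicator k (x - y)) +
        ∫⁻ y, ENNReal.ofReal (h y) * (Metric.ball 0 R)ᶜ.indicator k (x - y) := by
      rw [lintegral_add_left, lintegral_const_mul' _ _ ENNReal.ofReal_ne_top]
      exact ((hkm.indicator measurableSet_ball).comp (measurable_const.sub measurable_id)).const_mul _
    _ ≤ ENNReal.ofReal a * (ENNReal.ofReal (R ^ α) * J₁) +
        K * (ENNReal.ofReal (R ^ (-(N : ℝ))) * J₂) ^ (1 / r') := by
      gcongr
      · rw [lintegral_sub_left_eq_self (fun z => (Metric.ball 0 R).indicator k z) x, hin]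
      · have := ENNReal.lintegral_mul_le_Lp_mul_Lq volume hconj (f := fun y => ENNReal.ofReal (h y))
          (g := fun y => (Metric.ball 0 R)ᶜ.indicator k (x - y)) (by fun_prop)
          ((hkm.indicator measurableSet_ball.compl).comp
            (measurable_const.sub measurable_id)).aemeasurable
        rw [lintegral_sub_left_eq_self (fun z => ((Metric.ball 0 R)ᶜ.indicator k z) ^ r') x,
          hout] at this
        exact this
    _ = (J₁ + K * J₂ ^ (1 / r')) * ENNReal.ofReal (a ^ (((N : ℝ) - α) / (N + α))) := by
      rw [ENNReal.mul_rpow_of_nonneg _ _ (by positivity), ENNReal.ofReal_rpow_of_pos (by positivity),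
        ← mul_assoc, ← ENNReal.ofReal_mul ha.le]
      have e1 : a * R ^ α = a ^ (((N : ℝ) - α) / (N + α)) := by
        rw [hR, ← Real.rpow_mul ha.le]
        nth_rw 1 [← Real.rpow_one a]
        rw [← Real.rpow_add ha]; congr 1; field_simp; ring
      have e2 : (R ^ (-(N : ℝ))) ^ (1 / r') = a ^ (((N : ℝ) - α) / (N + α)) := by
        rw [hR, ← Real.rpow_mul ha.le, ← Real.rpow_mul ha.le, hr']; congr 1; field_simp
      rw [e1, e2]; ring

/-- Qualitative diagonal Hardy–Littlewood–Sobolev inequality. -/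
lemma lintegral_prod_kernel_lt_top_of_measurable (hN : 1 ≤ N) (hα : 0 < α) (hαN : α < N)
    {h : EuclideanSpace ℝ (Fin N) → ℝ} (hm : Measurable h)
    (hfin : ∫⁻ x, ENNReal.ofReal (h x) ^ (2 * N / (N + α)) < ⊤) :
    ∫⁻ x, ∫⁻ y, ENNReal.ofReal (h x) * (ENNReal.ofReal (h y) *
      ENNReal.ofReal (‖x - y‖ ^ (-((N : ℝ) - α)))) < ⊤ := by
  have hN0 : (0 : ℝ) < N := by exact_mod_cast hN
  have hNa : (0 : ℝ) < N + α := by linarith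
  obtain ⟨C, hC, hb⟩ := setLIntegral_level_mul_kernel_le hN hα hαN hm hfin
  set k : EuclideanSpace ℝ (Fin N) → ℝ≥0∞ := fun z => ENNReal.ofReal (‖z‖ ^ (-((N : ℝ) - α)))
    with hk
  have hkm : Measurable k := by fun_prop
  -- By symmetry the half {h(y) ≤ h(x)} suffices. There the level estimate with a = h(x) bounds the
  -- inner integral, and the extra factor h(x) raises the power to exactly 1 + (N-α)/(N+α) =
  -- 2N/(N+α).
  set A : EuclideanSpace ℝ (Fin N) → EuclideanSpace ℝ (Fin N) → ℝ≥0∞ := fun x y =>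
    ENNReal.ofReal (h x) * {y | h y ≤ h x}.indicator
      (fun y => ENNReal.ofReal (h y) * k (x - y)) y with hA
  have hAm : Measurable (Function.uncurry A) := by
    have : Function.uncurry A = {z : EuclideanSpace ℝ (Fin N) × EuclideanSpace ℝ (Fin N) |
        h z.2 ≤ h z.1}.indicator (fun z => ENNReal.ofReal (h z.1) *
          (ENNReal.ofReal (h z.2) * k (z.1 - z.2))) := by
      ext ⟨x, y⟩
      by_cases hxy : h y ≤ h x
      · simp [A, Function.uncurry, indicator, hxy]
      · simp [A, Function.uncurry, indicator, hxy]
    rw [this]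
    refine Measurable.indicator ?_ (measurableSet_le (hm.comp measurable_snd) (hm.comp measurable_fst))
    fun_prop
  have hAb : ∫⁻ x, ∫⁻ y, A x y < ⊤ := by
    calc ∫⁻ x, ∫⁻ y, A x y ≤ ∫⁻ x, C * ENNReal.ofReal (h x) ^ (2 * N / (N + α)) := by
          refine lintegral_mono fun x => ?_
          simp only [hA]
          rw [lintegral_const_mul' _ _ ENNReal.ofReal_ne_top]
          rcases le_or_gt (h x) 0 with hx | hx
          · rw [ENNReal.ofReal_of_nonpos hx, zero_mul]; exact zero_le
          · refine (mul_le_mul_right (hb x (h x) hx) _).trans (le_of_eq ?_)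
            rw [ENNReal.ofReal_rpow_of_pos hx, mul_left_comm, ← ENNReal.ofReal_mul hx.le]
            congr 2
            nth_rw 1 [← Real.rpow_one (h x)]
            rw [← Real.rpow_add hx]; congr 1; field_simp; ring
      _ < ⊤ := by
          rw [lintegral_const_mul' _ _ hC.ne]
          exact ENNReal.mul_lt_top hC hfin
  have hswap : ∫⁻ x, ∫⁻ y, A y x = ∫⁻ x, ∫⁻ y, A x y :=
    (lintegral_lintegral_swap hAm.aemeasurable).symm
  calc _ ≤ ∫⁻ x, ∫⁻ y, (A x y + A y x) := by
        refine lintegral_mono fun x => lintegral_mono fun y => ?_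
        rcases le_total (h y) (h x) with hxy | hxy
        · refine le_trans (le_of_eq ?_) (self_le_add_right _ _)
          simp [A, indicator, hxy, hk]
        · refine le_trans (le_of_eq ?_) (self_le_add_left _ _)
          simp only [A, indicator, mem_ofPred_eq, hxy, if_true, hk]
          rw [norm_sub_rev]; ring
    _ = ∫⁻ x, ((∫⁻ y, A x y) + ∫⁻ y, A y x) := by
        refine lintegral_congr fun x => lintegral_add_left ?_ _
        exact hAm.comp measurable_prodMk_left
    _ = (∫⁻ x, ∫⁻ y, A x y) + ∫⁻ x, ∫⁻ y, A y x := lintegral_add_left hAm.lintegral_prod_right' _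
    _ < ⊤ := by rw [hswap]; exact ENNReal.add_lt_top.2 ⟨hAb, hAb⟩

end HLS

/-- Integrability over the product space given by the Hardy–Littlewood–Sobolev inequality. -/
lemma integrable_prod_kernel_mul {N : ℕ} {α : ℝ} (hN : 1 ≤ N) (hα : 0 < α) (hαN : α < N)
    {f g : EuclideanSpace ℝ (Fin N) → ℝ}
    (hf : MemLp f (ENNReal.ofReal (2 * N / (N + α)))) (hg : MemLp g (ENNReal.ofReal (2 * N / (N + α)))) :
    Integrable (fun z : EuclideanSpace ℝ (Fin N) × EuclideanSpace ℝ (Fin N) =>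
      ‖z.1 - z.2‖ ^ (-((N : ℝ) - α)) * (f z.2 * g z.1)) := by
  have hN0 : (0 : ℝ) < N := by exact_mod_cast hN
  have hr : 0 < 2 * N / (N + α) := by positivity
  -- Dominating both f and g by one function reduces the bilinear statement to the diagonal one.
  set h : EuclideanSpace ℝ (Fin N) → ℝ := fun x => ‖f x‖ + ‖g x‖ with hh
  have hmem : MemLp h (ENNReal.ofReal (2 * N / (N + α))) := hf.norm.add hg.norm
  have hae := hmem.aestronglyMeasurable.aemeasurable
  obtain ⟨k, hkm, hk⟩ := hae
  have hfin : ∫⁻ x, ENNReal.ofReal (k x) ^ (2 * N / (N + α)) < ⊤ := by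
    have h1 := lintegral_rpow_enorm_lt_top_of_eLpNorm_lt_top
      (by simpa using hr) ENNReal.ofReal_ne_top hmem.eLpNorm_lt_top
    rw [ENNReal.toReal_ofReal hr.le] at h1
    refine lt_of_le_of_lt (le_of_eq ?_) h1
    refine lintegral_congr_ae ?_
    filter_upwards [hk] with x hx
    rw [← hx, Real.enorm_of_nonneg (by positivity)]
  have key := lintegral_prod_kernel_lt_top_of_measurable hN hα hαN hkm hfin
  have hk1 : ∀ᵐ z : EuclideanSpace ℝ (Fin N) × EuclideanSpace ℝ (Fin N), h z.1 = k z.1 :=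
    Measure.quasiMeasurePreserving_fst.ae_eq hk
  have hk2 : ∀ᵐ z : EuclideanSpace ℝ (Fin N) × EuclideanSpace ℝ (Fin N), h z.2 = k z.2 :=
    Measure.quasiMeasurePreserving_snd.ae_eq hk
  refine ⟨?_, ?_⟩
  · refine AEStronglyMeasurable.mul ?_ (AEStronglyMeasurable.mul ?_ ?_)
    · have : Measurable fun z : EuclideanSpace ℝ (Fin N) × EuclideanSpace ℝ (Fin N) =>
        ‖z.1 - z.2‖ ^ (-((N : ℝ) - α)) := by fun_prop
      exact this.aestronglyMeasurable
    · exact hf.aestronglyMeasurable.comp_quasiMeasurePreserving Measure.quasiMeasurePreserving_snd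
    · exact hg.aestronglyMeasurable.comp_quasiMeasurePreserving Measure.quasiMeasurePreserving_fst
  · rw [hasFiniteIntegral_iff_enorm]
    have hm : Measurable fun z : EuclideanSpace ℝ (Fin N) × EuclideanSpace ℝ (Fin N) =>
      ENNReal.ofReal (k z.1) * (ENNReal.ofReal (k z.2) *
      ENNReal.ofReal (‖z.1 - z.2‖ ^ (-((N : ℝ) - α)))) := by fun_prop
    have key2 := lintegral_prod (μ := volume) (ν := volume) _ hm.aemeasurable
    rw [← key2] at key
    refine lt_of_le_of_lt (lintegral_mono_ae ?_) key
    filter_upwards [hk1, hk2] with z h1 h2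
    rw [← h1, ← h2, enorm_mul, enorm_mul, Real.enorm_of_nonneg (by positivity)]
    have e1 : ‖f z.2‖ₑ ≤ ENNReal.ofReal (h z.2) := by
      rw [← ofReal_norm]; exact ENNReal.ofReal_le_ofReal (by simp only [hh]; linarith [norm_nonneg (g z.2)])
    have e2 : ‖g z.1‖ₑ ≤ ENNReal.ofReal (h z.1) := by
      rw [← ofReal_norm]; exact ENNReal.ofReal_le_ofReal (by simp only [hh]; linarith [norm_nonneg (f z.1)])
    calc _ ≤ ENNReal.ofReal (‖z.1 - z.2‖ ^ (-((N : ℝ) - α))) *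
          (ENNReal.ofReal (h z.2) * ENNReal.ofReal (h z.1)) := by gcongr
      _ = _ := by ring

/-! ### Dominated subsequences of L^s-convergent sequences -/

section Subsequence

variable {X F : Type*} [MeasurableSpace X] {μ : Measure X} [NormedAddCommGroup F]

/-- Partial converse of dominated convergence. Along a subsequence the s-th powers of the errors
have summable integrals, so their sum S is finite almost everywhere; its terms tend to zero, and
S^{1/s} + |w| is a common majorant in L^s. -/
lemma exists_subseq_dominated {s : ℝ} (hs : 1 ≤ s) {w : X → F} {v : ℕ → X → F}
    (hw : MemLp w (ENNReal.ofReal s) μ) (hv : ∀ n, AEStronglyMeasurable (v n) μ)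
    (hlim : Tendsto (fun n => ∫⁻ x, ‖v n x - w x‖ₑ ^ s ∂μ) atTop (𝓝 0)) :
    ∃ φ : ℕ → ℕ, StrictMono φ ∧ (∀ᵐ x ∂μ, Tendsto (fun n => v (φ n) x) atTop (𝓝 (w x))) ∧
      ∃ g : X → ℝ, MemLp g (ENNReal.ofReal s) μ ∧ ∀ᵐ x ∂μ, ∀ n, ‖v (φ n) x‖ ≤ g x := by
  have hs0 : 0 < s := by linarith
  obtain ⟨φ, hφ, hφ2⟩ := extraction_forall_of_eventually
    (P := fun k n => ∫⁻ x, ‖v n x - w x‖ₑ ^ s ∂μ ≤ (2⁻¹ : ℝ≥0∞) ^ k) (fun k => by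
      have : (0 : ℝ≥0∞) < 2⁻¹ ^ k := ENNReal.pow_pos (by simp) k
      filter_upwards [hlim.eventually (gt_mem_nhds this)] with n hn using hn.le)
  have hm : ∀ n, AEMeasurable (fun x => ‖v n x - w x‖ₑ ^ s) μ := fun n =>
    ((hv n).sub hw.aestronglyMeasurable).enorm.pow_const s
  set S : X → ℝ≥0∞ := fun x => ∑' k, ‖v (φ k) x - w x‖ₑ ^ s with hS
  have hSm : AEMeasurable S μ := AEMeasurable.tsum fun k => hm (φ k)
  have hSint : ∫⁻ x, S x ∂μ < ⊤ := by
    rw [lintegral_tsum fun k => hm (φ k)]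
    refine lt_of_le_of_lt (ENNReal.tsum_le_tsum hφ2) ?_
    rw [ENNReal.tsum_geometric]; simp
  have hSfin : ∀ᵐ x ∂μ, S x < ⊤ := ae_lt_top' hSm hSint.ne
  refine ⟨φ, hφ, ?_, fun x => (S x).toReal ^ (1 / s) + ‖w x‖, ?_, ?_⟩
  · filter_upwards [hSfin] with x hx
    have h1 : Tendsto (fun k => ‖v (φ k) x - w x‖ₑ ^ s) atTop (𝓝 0) :=
      ENNReal.tendsto_atTop_zero_of_tsum_ne_top hx.ne
    have h2 := (ENNReal.continuous_rpow_const (y := 1 / s)).tendsto 0 |>.comp h1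
    rw [ENNReal.zero_rpow_of_pos (by positivity)] at h2
    have h3 : (fun k => ‖v (φ k) x - w x‖ₑ) =
        (fun a : ℝ≥0∞ => a ^ (1 / s)) ∘ fun k => ‖v (φ k) x - w x‖ₑ ^ s := by
      ext k; simp only [Function.comp]
      rw [← ENNReal.rpow_mul, mul_one_div_cancel hs0.ne', ENNReal.rpow_one]
    rw [← h3] at h2
    rw [tendsto_iff_edist_tendsto_0]
    simpa [edist_eq_enorm_sub] using h2
  · refine MemLp.add ?_ hw.norm
    have hmm : AEStronglyMeasurable (fun x => (S x).toReal ^ (1 / s)) μ :=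
      (hSm.ennreal_toReal.pow_const _).aestronglyMeasurable
    refine ⟨hmm, ?_⟩
    rw [eLpNorm_lt_top_iff_lintegral_rpow_enorm_lt_top (by simpa using hs0) ENNReal.ofReal_ne_top,
      ENNReal.toReal_ofReal hs0.le]
    refine lt_of_le_of_lt (lintegral_mono_ae ?_) hSint
    filter_upwards [hSfin] with x hx
    rw [Real.enorm_of_nonneg (by positivity), ENNReal.ofReal_rpow_of_nonneg (by positivity) hs0.le,
      ← Real.rpow_mul (by positivity), one_div_mul_cancel hs0.ne', Real.rpow_one,
      ENNReal.ofReal_toReal hx.ne]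
  · filter_upwards [hSfin] with x hx n
    have h1 : ‖v (φ n) x - w x‖ₑ ^ s ≤ S x := ENNReal.le_tsum n
    have h2 : ‖v (φ n) x - w x‖ ^ s ≤ (S x).toReal := by
      have := ENNReal.toReal_mono hx.ne h1
      rwa [← ENNReal.toReal_rpow, toReal_enorm] at this
    have h3 : ‖v (φ n) x - w x‖ ≤ (S x).toReal ^ (1 / s) := by
      have := Real.rpow_le_rpow (by positivity) h2 (show 0 ≤ 1 / s by positivity)
      rwa [← Real.rpow_mul (by positivity), mul_one_div_cancel hs0.ne', Real.rpow_one] at this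
    calc ‖v (φ n) x‖ = ‖(v (φ n) x - w x) + w x‖ := by simp
      _ ≤ _ := (norm_add_le _ _).trans (by gcongr)

end Subsequence

/-! ### Mollifiers converge in L^s -/

section Mollification

variable {E F : Type*} [NormedAddCommGroup E] [InnerProductSpace ℝ E] [FiniteDimensional ℝ E]
  [MeasurableSpace E] [BorelSpace E] [NormedAddCommGroup F]

lemma tendsto_lintegral_translate_sub {s : ℝ} (hs : 1 ≤ s) {f : E → F}
    (hf : MemLp f (ENNReal.ofReal s)) :
    Tendsto (fun t : E => ∫⁻ x, ‖f (x - t) - f x‖ₑ ^ s) (𝓝 0) (𝓝 0) := by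
  have hs0 : 0 < s := by linarith
  have : Fact (1 ≤ ENNReal.ofReal s) := ⟨by simpa using hs⟩
  let g : C(E, C(E, E)) := (ContinuousMap.mk (fun a : E × E => a.2 - a.1) (by fun_prop)).curry
  have hg : ∀ t, MeasurePreserving (g t) (volume : Measure E) volume := fun t =>
    measurePreserving_sub_right volume t
  have hc : Continuous fun t => Lp.compMeasurePreserving (g t) (hg t) (hf.toLp f) :=
    continuous_const.compMeasurePreservingLp g.continuous hg ENNReal.ofReal_ne_top
  have h0 := hc.tendsto 0
  rw [tendsto_iff_edist_tendsto_0] at h0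
  have h1 := (ENNReal.continuous_rpow_const (y := s)).tendsto 0 |>.comp h0
  rw [ENNReal.zero_rpow_of_pos hs0] at h1
  refine h1.congr fun t => ?_
  simp only [Function.comp]
  rw [Lp.edist_def, eLpNorm_eq_lintegral_rpow_enorm_toReal (by simpa using hs0) ENNReal.ofReal_ne_top,
    ENNReal.toReal_ofReal hs0.le, ← ENNReal.rpow_mul, one_div_mul_cancel hs0.ne', ENNReal.rpow_one]
  refine lintegral_congr_ae ?_
  have e1 : ∀ t, (Lp.compMeasurePreserving (g t) (hg t) (hf.toLp f) : E → F) =ᵐ[volume]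
      fun x => f (x - t) := fun t =>
    (Lp.coeFn_compMeasurePreserving _ (hg t)).trans
      ((hg t).quasiMeasurePreserving.ae_eq_comp hf.coeFn_toLp)
  filter_upwards [e1 t, e1 0] with x hx h0
  simp only [Pi.sub_apply, hx, h0, sub_zero]

variable [NormedSpace ℝ F] [CompleteSpace F]

/-- Jensen for the probability density η: the error is an η-average of f(x - t) - f(x), so its s-th
power is at most the average of the s-th powers. Tonelli then reduces the bound to translates by t
in the support of η. -/
lemma lintegral_mollify_sub_le {s : ℝ} (hs : 1 ≤ s) {f : E → F}
    (hf : MemLp f (ENNReal.ofReal s)) (ρ : ContDiffBump (0 : E)) {δ : ℝ≥0∞}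
    (hδ : ∀ t ∈ Metric.ball (0 : E) ρ.rOut, ∫⁻ x, ‖f (x - t) - f x‖ₑ ^ s ≤ δ) :
    ∫⁻ x, ‖(ρ.normed volume ⋆[ContinuousLinearMap.lsmul ℝ ℝ, volume] f) x - f x‖ₑ ^ s ≤ δ := by
  have hs0 : 0 < s := by linarith
  set η := ρ.normed volume with hη
  have hηc : Continuous η := ρ.continuous_normed
  have hηi : Integrable η := ρ.integrable_normed
  have hη1 : ∫⁻ t, ENNReal.ofReal (η t) = 1 := by
    rw [← ofReal_integral_eq_lintegral_ofReal hηi (ae_of_all _ ρ.nonneg_normed), ρ.integral_normed]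
    simp
  have hloc : LocallyIntegrable f := hf.locallyIntegrable (by simpa using hs)
  have hm : AEStronglyMeasurable (fun z : E × E => f (z.1 - z.2) - f z.1) (volume.prod volume) := by
    refine AEStronglyMeasurable.sub ?_ ?_
    · exact hf.aestronglyMeasurable.comp_quasiMeasurePreserving
        (quasiMeasurePreserving_sub_of_right_invariant volume volume)
    · exact hf.aestronglyMeasurable.comp_quasiMeasurePreserving Measure.quasiMeasurePreserving_fst
  have hpt : ∀ᵐ x, ‖(η ⋆[ContinuousLinearMap.lsmul ℝ ℝ, volume] f) x - f x‖ₑ ^ s ≤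
      ∫⁻ t, ENNReal.ofReal (η t) * ‖f (x - t) - f x‖ₑ ^ s := by
    filter_upwards [hm.prodMk_left] with x hx
    have hmx : AEMeasurable (fun t => ‖f (x - t) - f x‖ₑ) := hx.enorm
    have hex := (ρ.hasCompactSupport_normed (μ := volume)).convolutionExists_left
      (ContinuousLinearMap.lsmul ℝ ℝ) hηc hloc x
    have e1 : (η ⋆[ContinuousLinearMap.lsmul ℝ ℝ, volume] f) x - f x =
        ∫ t, η t • (f (x - t) - f x) := by
      have hi1 : Integrable fun t => η t • f (x - t) := hex
      have hi2 : Integrable fun t => η t • f x := hηi.smul_const _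
      simp_rw [smul_sub]
      rw [integral_sub hi1 hi2, integral_smul_const, ρ.integral_normed, one_smul]
      rfl
    -- Writing η = η^{1-1/s} η^{1/s} prepares Hölder with exponents 1 - 1/s and 1/s, in a form that
    -- includes s = 1.
    have e2 : ‖(η ⋆[ContinuousLinearMap.lsmul ℝ ℝ, volume] f) x - f x‖ₑ ≤
        ∫⁻ t, ENNReal.ofReal (η t) ^ (1 - 1 / s) *
          (ENNReal.ofReal (η t) * ‖f (x - t) - f x‖ₑ ^ s) ^ (1 / s) := by
      rw [e1]
      refine (enorm_integral_le_lintegral_enorm _).trans (le_of_eq (lintegral_congr fun t => ?_))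
      rw [enorm_smul, Real.enorm_of_nonneg (ρ.nonneg_normed t),
        ENNReal.mul_rpow_of_nonneg _ _ (by positivity), ← mul_assoc,
        ← ENNReal.rpow_mul, mul_one_div_cancel hs0.ne', ENNReal.rpow_one,
        ← ENNReal.rpow_add_of_nonneg]
      · simp [hη]
      · rw [sub_nonneg, div_le_one hs0]; exact hs
      · positivity
    have e3 := ENNReal.lintegral_mul_norm_pow_le (μ := (volume : Measure E))
      (f := fun t => ENNReal.ofReal (η t))
      (g := fun t => ENNReal.ofReal (η t) * ‖f (x - t) - f x‖ₑ ^ s)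
      (by fun_prop) (by fun_prop)
      (show 0 ≤ 1 - 1 / s by rw [sub_nonneg, div_le_one hs0]; exact hs)
      (show 0 ≤ 1 / s by positivity) (by ring)
    rw [hη1, ENNReal.one_rpow, one_mul] at e3
    calc _ ≤ ((∫⁻ t, ENNReal.ofReal (η t) * ‖f (x - t) - f x‖ₑ ^ s) ^ (1 / s)) ^ s := by
          gcongr; exact e2.trans e3
      _ = _ := by rw [← ENNReal.rpow_mul, one_div_mul_cancel hs0.ne', ENNReal.rpow_one]
  have hmm : AEMeasurable (Function.uncurry fun x t : E =>
      ENNReal.ofReal (η t) * ‖f (x - t) - f x‖ₑ ^ s) (volume.prod volume) := by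
    refine AEMeasurable.mul ?_ (hm.enorm.pow_const s)
    have : Measurable fun z : E × E => ENNReal.ofReal (η z.2) := by fun_prop
    exact this.aemeasurable
  calc _ ≤ ∫⁻ x, ∫⁻ t, ENNReal.ofReal (η t) * ‖f (x - t) - f x‖ₑ ^ s := lintegral_mono_ae hpt
    _ = ∫⁻ t, ∫⁻ x, ENNReal.ofReal (η t) * ‖f (x - t) - f x‖ₑ ^ s := lintegral_lintegral_swap hmm
    _ = ∫⁻ t, ENNReal.ofReal (η t) * ∫⁻ x, ‖f (x - t) - f x‖ₑ ^ s := by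
      simp_rw [lintegral_const_mul' _ _ ENNReal.ofReal_ne_top]
    _ ≤ ∫⁻ t, ENNReal.ofReal (η t) * δ := by
      refine lintegral_mono fun t => ?_
      by_cases ht : t ∈ Metric.ball (0 : E) ρ.rOut
      · simp only; gcongr; exact hδ t ht
      · have : η t = 0 := by
          rw [← Function.notMem_support, hη, ρ.support_normed_eq]; exact ht
        simp [this]
    _ = δ := by rw [lintegral_mul_const _ (by fun_prop), hη1, one_mul]

lemma tendsto_lintegral_mollify_sub {s : ℝ} (hs : 1 ≤ s) {f : E → F}
    (hf : MemLp f (ENNReal.ofReal s)) {ρ : ℕ → ContDiffBump (0 : E)}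
    (hρ : Tendsto (fun n => (ρ n).rOut) atTop (𝓝 0)) :
    Tendsto (fun n => ∫⁻ x,
      ‖((ρ n).normed volume ⋆[ContinuousLinearMap.lsmul ℝ ℝ, volume] f) x - f x‖ₑ ^ s)
      atTop (𝓝 0) := by
  rw [ENNReal.tendsto_nhds_zero]
  intro ε hε
  have h := (ENNReal.tendsto_nhds_zero.1 (tendsto_lintegral_translate_sub hs hf)) ε hε
  obtain ⟨r, hr, hb⟩ := Metric.eventually_nhds_iff_ball.1 h
  filter_upwards [hρ.eventually (gt_mem_nhds hr)] with n hn
  exact lintegral_mollify_sub_le hs hf (ρ n) fun t ht => hb t (Metric.ball_subset_ball hn.le ht)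

end Mollification

/-! ### Weak gradients: uniqueness, Leibniz rule, smooth approximation -/

section WeakGradient

variable {N : ℕ}

local notation "E" => EuclideanSpace ℝ (Fin N)

lemma gradient_apply_eq_fderiv (η : E → ℝ) (x : E) (i : Fin N) :
    gradient η x i = fderiv ℝ η x (EuclideanSpace.single i 1) := by
  have : inner ℝ (gradient η x) (EuclideanSpace.single i (1 : ℝ)) =
      fderiv ℝ η x (EuclideanSpace.single i 1) := by
    rw [gradient, InnerProductSpace.toDual_symm_apply]
  rw [← this, EuclideanSpace.inner_single_right]; simp

lemma continuous_gradient {η : E → ℝ} (hη : ContDiff ℝ ∞ η) : Continuous (gradient η) :=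
  (InnerProductSpace.toDual ℝ E).symm.continuous.comp (hη.continuous_fderiv (by simp))

lemma hasCompactSupport_fderiv_apply {η : E → ℝ} (hη : HasCompactSupport η) (v : E) :
    HasCompactSupport fun x => fderiv ℝ η x v :=
  hη.fderiv_apply (𝕜 := ℝ) v

lemma continuous_fderiv_apply_const {η : E → ℝ} (hη : ContDiff ℝ ∞ η) (v : E) :
    Continuous fun x => fderiv ℝ η x v :=
  (hη.continuous_fderiv (by simp)).clm_apply continuous_const

lemma hasCompactSupport_gradient {η : E → ℝ} (hη : HasCompactSupport η) :
    HasCompactSupport (gradient η) :=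
  (hη.fderiv (𝕜 := ℝ)).comp_left (g := (InnerProductSpace.toDual ℝ E).symm) (map_zero _)

lemma locallyIntegrable_coord {G : E → E} (hG : LocallyIntegrable G) (i : Fin N) :
    LocallyIntegrable fun x => G x i := by
  intro x
  obtain ⟨s, hs, hi⟩ := hG x
  exact ⟨s, hs, (EuclideanSpace.proj (𝕜 := ℝ) i).integrable_comp hi⟩

/-- The fundamental lemma of the calculus of variations in each coordinate. It identifies the
gradients that come separately from `MemW12`, from `IsWeakSolution` and from the theorem's own
hypothesis. -/
lemma HasWeakGradient.ae_eq {u : E → ℝ} {G G' : E → E} (h : HasWeakGradient u G)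
    (h' : HasWeakGradient u G') : G =ᵐ[volume] G' := by
  have : ∀ i : Fin N, ∀ᵐ x, G x i = G' x i := fun i => by
    refine ae_eq_of_integral_contDiff_smul_eq (locallyIntegrable_coord h.2.1 i)
      (locallyIntegrable_coord h'.2.1 i) fun φ hφ hc => ?_
    have e1 := h.2.2 i φ hφ hc
    have e2 := h'.2.2 i φ hφ hc
    simp only [smul_eq_mul, mul_comm (φ _)]
    linarith
  filter_upwards [ae_all_iff.2 this] with x hx
  ext i; exact hx i

/-- Since η is smooth, ηφ is again an admissible test function for w; the classical product rule for
ηφ yields the Leibniz rule. -/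
lemma HasWeakGradient.smul {w η : E → ℝ} {G : E → E} (h : HasWeakGradient w G)
    (hη : ContDiff ℝ ∞ η) :
    HasWeakGradient (fun x => η x * w x) (fun x => η x • G x + w x • gradient η x) := by
  refine ⟨?_, ?_, ?_⟩
  · exact h.1.continuous_smul hη.continuous
  · exact (h.2.1.continuous_smul hη.continuous).add
      (h.1.smul_continuous (continuous_gradient hη))
  · intro i φ hφ hc
    have e := h.2.2 i (fun x => η x * φ x) (hη.mul hφ) hc.mul_left
    have hfd : ∀ x, fderiv ℝ (fun x => η x * φ x) x (EuclideanSpace.single i 1) =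
        η x * fderiv ℝ φ x (EuclideanSpace.single i 1) +
          φ x * fderiv ℝ η x (EuclideanSpace.single i 1) := fun x => by
      rw [fderiv_fun_mul (hη.differentiable (by simp) x) (hφ.differentiable (by simp) x)]
      simp
    simp_rw [hfd] at e
    have i1 : Integrable fun x => w x * (η x * fderiv ℝ φ x (EuclideanSpace.single i 1)) :=
      h.1.integrable_smul_right_of_hasCompactSupport
        (hη.continuous.mul (continuous_fderiv_apply_const hφ _))
        (hasCompactSupport_fderiv_apply hc _).mul_left
    have i2 : Integrable fun x => w x * (φ x * fderiv ℝ η x (EuclideanSpace.single i 1)) :=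
      h.1.integrable_smul_right_of_hasCompactSupport
        (hφ.continuous.mul (continuous_fderiv_apply_const hη _)) hc.mul_right
    have i3 : Integrable fun x => G x i * (η x * φ x) :=
      (locallyIntegrable_coord h.2.1 i).integrable_smul_right_of_hasCompactSupport
        (hη.continuous.mul hφ.continuous) hc.mul_left
    have s1 : ∫ x, η x * w x * fderiv ℝ φ x (EuclideanSpace.single i 1) =
        ∫ x, w x * (η x * fderiv ℝ φ x (EuclideanSpace.single i 1)) := by
      congr 1; ext x; ring
    have s2 : ∫ x, (η x • G x + w x • gradient η x) i * φ x =
        (∫ x, G x i * (η x * φ x)) +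
          ∫ x, w x * (φ x * fderiv ℝ η x (EuclideanSpace.single i 1)) := by
      rw [← integral_add i3 i2]
      congr 1; ext x
      simp only [PiLp.add_apply, PiLp.smul_apply, smul_eq_mul, gradient_apply_eq_fderiv]; ring
    simp_rw [mul_add] at e
    rw [integral_add i1 i2] at e
    rw [s1, s2]; linarith

lemma MemLpLoc.memLp_smul {F : Type*} [NormedAddCommGroup F] [NormedSpace ℝ F] {g : E → F}
    {q : ℝ≥0∞} (hg : MemLpLoc g q) {η : E → ℝ} (hη : Continuous η) (hc : HasCompactSupport η) :
    MemLp (fun x => η x • g x) q := by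
  have hK : IsCompact (tsupport η) := hc
  have e : (fun x => η x • g x) = (tsupport η).indicator fun x => η x • g x := by
    ext x
    by_cases hx : x ∈ tsupport η
    · rw [indicator_of_mem hx]
    · rw [indicator_of_notMem hx, image_eq_zero_of_notMem_tsupport hx, zero_smul]
  rw [e, memLp_indicator_iff_restrict hK.measurableSet]
  obtain ⟨C, hC⟩ := hη.bounded_above_of_compact_support hc
  refine (hg _ hK).of_le_mul (c := C) (hη.aestronglyMeasurable.smul (hg _ hK).aestronglyMeasurable)
    (ae_of_all _ fun x => ?_)
  rw [norm_smul]
  gcongr; exact hC x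

lemma MemLpLoc.memLp_smul' {F : Type*} [NormedAddCommGroup F] [NormedSpace ℝ F] {g : E → ℝ}
    {q : ℝ≥0∞} (hg : MemLpLoc g q) {η : E → F} (hη : Continuous η) (hc : HasCompactSupport η) :
    MemLp (fun x => g x • η x) q := by
  have h := hg.memLp_smul hη.norm hc.norm
  refine h.mono ?_ (ae_of_all _ fun x => ?_)
  · have e : (fun x => g x • η x) = (tsupport η).indicator fun x => g x • η x := by
      ext x
      by_cases hx : x ∈ tsupport η
      · rw [indicator_of_mem hx]
      · rw [indicator_of_notMem hx, image_eq_zero_of_notMem_tsupport hx, smul_zero]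
    have hK : IsCompact (tsupport η) := hc
    rw [e, aestronglyMeasurable_indicator_iff hK.measurableSet]
    exact (hg _ hK).aestronglyMeasurable.smul hη.aestronglyMeasurable
  · simp [norm_smul, mul_comm]

lemma memLpLoc_of_memLp {F : Type*} [NormedAddCommGroup F] {g : E → F}
    {q : ℝ≥0∞} (hg : MemLp g q) : MemLpLoc g q := fun K _ => hg.restrict K

lemma MemLpLoc.mono_exponent {F : Type*} [NormedAddCommGroup F] {g : E → F}
    {q r : ℝ≥0∞} (hg : MemLpLoc g q) (hrq : r ≤ q) : MemLpLoc g r := fun K hK => by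
  have : IsFiniteMeasure (volume.restrict K) := ⟨by simpa using hK.measure_lt_top⟩
  exact (hg K hK).mono_exponent hrq

lemma MemLpLoc.coord {G : E → E} {q : ℝ≥0∞} (hG : MemLpLoc G q) (i : Fin N) :
    MemLpLoc (fun x => G x i) q := fun K hK =>
  (EuclideanSpace.proj (𝕜 := ℝ) i).comp_memLp' (hG K hK)

lemma exists_cutoff {K : Set E} (hK : IsCompact K) :
    ∃ χ : E → ℝ, ContDiff ℝ ∞ χ ∧ HasCompactSupport χ ∧ ∀ x ∈ K, χ =ᶠ[𝓝 x] 1 := by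
  obtain ⟨R, hR0, hR⟩ := hK.isBounded.subset_ball_lt 0 0
  let b : ContDiffBump (0 : E) := ⟨R, R + 1, hR0, by linarith⟩
  refine ⟨b, b.contDiff, b.hasCompactSupport, fun x hx => ?_⟩
  exact b.eventuallyEq_one_of_mem_ball (hR hx)

/-- The derivative of the convolution falls on the mollifier, and t ↦ ρ(x - t) is a test function
for the weak gradient. The sign from the reflection cancels the one from the weak formulation. -/
lemma gradient_mollify {w : E → ℝ} {G : E → E} (h : HasWeakGradient w G)
    (ρ : ContDiffBump (0 : E)) (x : E) :
    gradient (ρ.normed volume ⋆[ContinuousLinearMap.lsmul ℝ ℝ, volume] w) x =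
      (ρ.normed volume ⋆[ContinuousLinearMap.lsmul ℝ ℝ, volume] G) x := by
  have hc := ρ.hasCompactSupport_normed (μ := (volume : Measure E))
  have hs : ContDiff ℝ ∞ (ρ.normed volume) := ρ.contDiff_normed
  ext i
  rw [gradient_apply_eq_fderiv,
    (hc.hasFDerivAt_convolution_left (ContinuousLinearMap.lsmul ℝ ℝ) (hs.of_le (by simp)) h.1 x).fderiv,
    convolution_eq_swap, convolution_eq_swap]
  have hex := hc.convolutionExists_left (ContinuousLinearMap.lsmul ℝ ℝ) hs.continuous h.2.1 x
  have hex2 := (hc.fderiv (𝕜 := ℝ)).convolutionExists_left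
    ((ContinuousLinearMap.lsmul ℝ ℝ : ℝ →L[ℝ] ℝ →L[ℝ] ℝ).precompL E)
    (hs.continuous_fderiv (by simp)) h.1 x
  have hφ : ContDiff ℝ ∞ fun t : E => ρ.normed volume (x - t) :=
    hs.comp (contDiff_const.sub contDiff_id)
  have hφc : HasCompactSupport fun t : E => ρ.normed volume (x - t) :=
    hc.comp_homeomorph (Homeomorph.subLeft x)
  have key := h.2.2 i _ hφ hφc
  have hfd : ∀ t, fderiv ℝ (fun t : E => ρ.normed volume (x - t)) t (EuclideanSpace.single i 1) =
      - fderiv ℝ (ρ.normed volume) (x - t) (EuclideanSpace.single i 1) := fun t => by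
    have h1 : HasFDerivAt (fun t : E => x - t) (-ContinuousLinearMap.id ℝ E) t := by
      simpa using (hasFDerivAt_id t).const_sub x
    have h2 := (hs.differentiable (by simp) (x - t)).hasFDerivAt.comp t h1
    have h3 : fderiv ℝ (fun t : E => ρ.normed volume (x - t)) t = _ := h2.fderiv
    rw [h3]; simp
  simp_rw [hfd, mul_neg, integral_neg] at key
  have key := neg_injective key
  have a1 := (EuclideanSpace.proj (𝕜 := ℝ) i).integral_comp_comm hex.integrable_swap
  have a2 := ContinuousLinearMap.integral_apply hex2.integrable_swap (EuclideanSpace.single i 1)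
  simp only [PiLp.proj_apply, ContinuousLinearMap.lsmul_apply, PiLp.smul_apply, smul_eq_mul] at a1
  rw [a2]
  simp only [ContinuousLinearMap.precompL_apply, ContinuousLinearMap.lsmul_apply, smul_eq_mul]
  refine Eq.trans ?_ a1
  simp_rw [mul_comm (fderiv ℝ _ _ _), mul_comm (ContDiffBump.normed _ _ _)]
  exact key

/-- A single sequence of mollifications must serve several limits at once: w in two Lebesgue spaces
and its gradient in a third, each with a pointwise majorant. Three successive extractions produce
it, since majorants and limits survive passing to subsequences. -/
lemma exists_smooth_approx {w : E → ℝ} {G : E → E} (h : HasWeakGradient w G) {s₁ s₂ s₃ : ℝ}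
    (h₁ : 1 ≤ s₁) (h₂ : 1 ≤ s₂) (h₃ : 1 ≤ s₃) (hw₁ : MemLp w (ENNReal.ofReal s₁))
    (hw₂ : MemLp w (ENNReal.ofReal s₂)) (hG : MemLp G (ENNReal.ofReal s₃)) :
    ∃ v : ℕ → E → ℝ, (∀ n, ContDiff ℝ ∞ (v n)) ∧
      (HasCompactSupport w → ∀ n, HasCompactSupport (v n)) ∧
      (∀ᵐ x, Tendsto (fun n => v n x) atTop (𝓝 (w x))) ∧
      (∀ᵐ x, Tendsto (fun n => gradient (v n) x) atTop (𝓝 (G x))) ∧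
      (∃ g : E → ℝ, MemLp g (ENNReal.ofReal s₁) ∧ ∀ᵐ x, ∀ n, ‖v n x‖ ≤ g x) ∧
      (∃ g : E → ℝ, MemLp g (ENNReal.ofReal s₂) ∧ ∀ᵐ x, ∀ n, ‖v n x‖ ≤ g x) ∧
      (∃ g : E → ℝ, MemLp g (ENNReal.ofReal s₃) ∧ ∀ᵐ x, ∀ n, ‖gradient (v n) x‖ ≤ g x) := by
  let ρ : ℕ → ContDiffBump (0 : E) := fun n =>
    ⟨1 / (n + 1 : ℝ), 2 / (n + 1 : ℝ), by positivity, by gcongr; norm_num⟩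
  have hρ : Tendsto (fun n => (ρ n).rOut) atTop (𝓝 0) := by
    have := tendsto_one_div_add_atTop_nhds_zero_nat (𝕜 := ℝ) |>.const_mul 2
    simpa [ρ, mul_one_div, div_eq_mul_inv] using this
  let W : ℕ → E → ℝ := fun n =>
    (ρ n).normed volume ⋆[ContinuousLinearMap.lsmul ℝ ℝ, volume] w
  let V : ℕ → E → E := fun n =>
    (ρ n).normed volume ⋆[ContinuousLinearMap.lsmul ℝ ℝ, volume] G
  have hcs := fun n => (ρ n).hasCompactSupport_normed (μ := (volume : Measure E))
  have hsm : ∀ n, ContDiff ℝ ∞ ((ρ n).normed (volume : Measure E)) := fun n => (ρ n).contDiff_normed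
  have hWs : ∀ n, ContDiff ℝ ∞ (W n) := fun n =>
    (hcs n).contDiff_convolution_left _ (hsm n) h.1
  have hWm : ∀ n, AEStronglyMeasurable (W n) volume := fun n => (hWs n).continuous.aestronglyMeasurable
  have hVm : ∀ n, AEStronglyMeasurable (V n) volume := fun n =>
    ((hcs n).continuous_convolution_left _ (hsm n).continuous h.2.1).aestronglyMeasurable
  obtain ⟨φ₁, hφ₁, -, g₁, hg₁, hb₁⟩ := exists_subseq_dominated h₁ hw₁ hWm
    (tendsto_lintegral_mollify_sub h₁ hw₁ hρ)
  obtain ⟨φ₂, hφ₂, hl₂, g₂, hg₂, hb₂⟩ := exists_subseq_dominated h₂ hw₂ (fun n => hWm (φ₁ n))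
    ((tendsto_lintegral_mollify_sub h₂ hw₂ hρ).comp hφ₁.tendsto_atTop)
  obtain ⟨φ₃, hφ₃, hl₃, g₃, hg₃, hb₃⟩ := exists_subseq_dominated h₃ hG
    (fun n => hVm (φ₁ (φ₂ n)))
    ((tendsto_lintegral_mollify_sub h₃ hG hρ).comp (hφ₁.comp hφ₂).tendsto_atTop)
  have hgr : ∀ n, gradient (W n) = V n := fun n => funext fun x => gradient_mollify h (ρ n) x
  refine ⟨fun n => W (φ₁ (φ₂ (φ₃ n))), fun n => hWs _, fun hc n => ?_, ?_, ?_, ⟨g₁, hg₁, ?_⟩,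
    ⟨g₂, hg₂, ?_⟩, ⟨g₃, hg₃, ?_⟩⟩
  · exact (hcs _).convolution _ hc
  · filter_upwards [hl₂] with x hx using hx.comp hφ₃.tendsto_atTop
  · simp_rw [hgr]; exact hl₃
  · filter_upwards [hb₁] with x hx n using hx _
  · filter_upwards [hb₂] with x hx n using hx _
  · simp_rw [hgr]; exact hb₃

end WeakGradient

/-! ### The nonlinearity |s|^{p-2}s -/

lemma continuous_abs_rpow_mul_self {p : ℝ} (hp : 1 < p) :
    Continuous fun s : ℝ => |s| ^ (p - 2) * s := by
  have h := (contDiff_norm_rpow (E := ℝ) hp).continuous_deriv le_rfl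
  -- For p < 2 the factor |s|^{p-2} is unbounded near 0, so continuity is read off from the C¹
  -- function |s|^p, whose derivative is p times this product.
  have e : (fun s : ℝ => |s| ^ (p - 2) * s) = fun s => p⁻¹ * deriv (fun x : ℝ => ‖x‖ ^ p) s := by
    ext s
    rw [(hasDerivAt_norm_rpow s hp).deriv, Real.norm_eq_abs]
    field_simp
  rw [e]; fun_prop

lemma abs_rpow_sub_two_mul_self {p : ℝ} (hp : 1 < p) (s : ℝ) :
    |(|s| ^ (p - 2) * s)| = |s| ^ (p - 1) := by
  rw [abs_mul, abs_of_nonneg (by positivity)]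
  rcases eq_or_ne s 0 with rfl | hs
  · rw [abs_zero, mul_zero, Real.zero_rpow (by linarith)]
  · have : 0 < |s| := abs_pos.2 hs
    nth_rw 2 [← Real.rpow_one |s|]
    rw [← Real.rpow_add this]; congr 1; ring

/-- A crude Young inequality, from replacing the smaller of a and b by the larger. The constant is
irrelevant because it only feeds integrability and domination. -/
lemma rpow_sub_one_mul_le {p a b : ℝ} (hp : 1 < p) (ha : 0 ≤ a) (hb : 0 ≤ b) :
    a ^ (p - 1) * b ≤ a ^ p + b ^ p := by
  have key : ∀ c : ℝ, 0 ≤ c → c ^ (p - 1) * c = c ^ p := fun c hc => by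
    nth_rw 2 [← Real.rpow_one c]
    rw [← Real.rpow_add_of_nonneg hc (by linarith) zero_le_one]; congr 1; ring
  rcases le_total a b with h | h
  · calc a ^ (p - 1) * b ≤ b ^ (p - 1) * b := by
          gcongr
      _ = b ^ p := key b hb
      _ ≤ _ := le_add_of_nonneg_left (by positivity)
  · calc a ^ (p - 1) * b ≤ a ^ (p - 1) * a := by gcongr
      _ = a ^ p := key a ha
      _ ≤ _ := le_add_of_nonneg_right (by positivity)

lemma abs_rpow_mul_self_mul_le {p a b s t : ℝ} (hp : 1 < p) (hs : |s| ≤ a) (ht : |t| ≤ b) :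
    |(|s| ^ (p - 2) * s * t)| ≤ a ^ p + b ^ p := by
  have ha := (abs_nonneg _).trans hs
  have hb := (abs_nonneg _).trans ht
  rw [abs_mul, abs_rpow_sub_two_mul_self hp]
  refine le_trans ?_ (rpow_sub_one_mul_le hp ha hb)
  have : 0 ≤ p - 1 := by linarith
  gcongr

/-! ### Weak chain rule for |w|^p -/

section ChainRule

variable {N : ℕ}

local notation "E" => EuclideanSpace ℝ (Fin N)

lemma integrable_abs_rpow_of_memLp {f : E → ℝ} {p : ℝ} (hp : 0 < p)
    (hf : MemLp f (ENNReal.ofReal p)) : Integrable fun x => |f x| ^ p := by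
  have := hf.integrable_norm_rpow (by simpa using hp) ENNReal.ofReal_ne_top
  simpa [ENNReal.toReal_ofReal hp.le] using this

lemma integral_chain_rule_of_memLp {p : ℝ} (hp : 1 < p) {w : E → ℝ} {G : E → E}
    (h : HasWeakGradient w G) (hw : MemLp w (ENNReal.ofReal p)) (hG : MemLp G (ENNReal.ofReal p))
    (i : Fin N) {ψ : E → ℝ} (hψ : ContDiff ℝ ∞ ψ) (hc : HasCompactSupport ψ) :
    p * ∫ x, |w x| ^ (p - 2) * w x * G x i * ψ x =
      - ∫ x, |w x| ^ p * fderiv ℝ ψ x (EuclideanSpace.single i 1) := by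
  obtain ⟨v, hvs, -, hvl, hgl, ⟨g₁, hg₁, hb₁⟩, -, ⟨g₃, hg₃, hb₃⟩⟩ :=
    exists_smooth_approx h hp.le hp.le hp.le hw hw hG
  obtain ⟨C, hC⟩ := hψ.continuous.bounded_above_of_compact_support hc
  obtain ⟨C', hC'⟩ := (continuous_fderiv_apply_const hψ
    (EuclideanSpace.single i 1)).bounded_above_of_compact_support (hasCompactSupport_fderiv_apply hc _)
  have hC0 : 0 ≤ C := (norm_nonneg _).trans (hC 0)
  have hI₁ := integrable_abs_rpow_of_memLp (by linarith) hg₁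
  have hI₃ := integrable_abs_rpow_of_memLp (by linarith) hg₃
  have hcts := continuous_abs_rpow_mul_self hp
  have hgc : ∀ n, Continuous fun x => gradient (v n) x i := fun n =>
    (EuclideanSpace.proj (𝕜 := ℝ) i).continuous.comp (continuous_gradient (hvs n))
  have hpc : ∀ n, Continuous fun x => |v n x| ^ p := fun n =>
    (hvs n).continuous.abs.rpow_const fun x => Or.inr (by linarith)
  have hvc : ∀ n, Continuous fun x => |v n x| ^ (p - 2) * v n x := fun n =>
    hcts.comp (hvs n).continuous
  have key : ∀ n, p * ∫ x, |v n x| ^ (p - 2) * v n x * gradient (v n) x i * ψ x =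
      - ∫ x, |v n x| ^ p * fderiv ℝ ψ x (EuclideanSpace.single i 1) := fun n => by
    have hd : ∀ x, HasFDerivAt (fun x => |v n x| ^ p)
        ((p * |v n x| ^ (p - 2) * v n x) • fderiv ℝ (v n) x) x := fun x =>
      (hasDerivAt_abs_rpow (v n x) hp).comp_hasFDerivAt x
        ((hvs n).differentiable (by simp) x).hasFDerivAt
    have hfd : ∀ x, fderiv ℝ (fun x => |v n x| ^ p) x (EuclideanSpace.single i 1) * ψ x =
        p * (|v n x| ^ (p - 2) * v n x * gradient (v n) x i * ψ x) := fun x => by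
      rw [(hd x).fderiv, gradient_apply_eq_fderiv]; simp; ring
    have := integral_mul_fderiv_eq_neg_fderiv_mul_of_integrable (μ := (volume : Measure E))
      (f := fun x => |v n x| ^ p) (g := ψ) (v := EuclideanSpace.single i 1)
      (by
        simp_rw [hfd]
        exact ((((hvc n).mul (hgc n)).mul hψ.continuous).integrable_of_hasCompactSupport
          hc.mul_left).const_mul _)
      (((hpc n).mul (continuous_fderiv_apply_const hψ _)).integrable_of_hasCompactSupport
        (hasCompactSupport_fderiv_apply hc _).mul_left)
      (((hpc n).mul hψ.continuous).integrable_of_hasCompactSupport hc.mul_left)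
      (fun x _ => (hd x).differentiableAt) (fun x _ => hψ.differentiable (by simp) x)
    rw [this, neg_neg]
    simp_rw [hfd]
    rw [integral_const_mul]
  have lim1 : Tendsto (fun n => ∫ x, |v n x| ^ (p - 2) * v n x * gradient (v n) x i * ψ x) atTop
      (𝓝 (∫ x, |w x| ^ (p - 2) * w x * G x i * ψ x)) := by
    refine tendsto_integral_of_dominated_convergence
      (fun x => (|g₁ x| ^ p + |g₃ x| ^ p) * C) (fun n =>
        (((hvc n).mul (hgc n)).mul hψ.continuous).aestronglyMeasurable)
      ((hI₁.add hI₃).mul_const C) (fun n => ?_) ?_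
    · filter_upwards [hb₁, hb₃] with x h1 h3
      rw [norm_mul]
      gcongr
      · refine abs_rpow_mul_self_mul_le hp ((h1 n).trans (le_abs_self _)) ?_
        exact (PiLp.norm_apply_le _ i).trans ((h3 n).trans (le_abs_self _))
      · exact hC x
    · filter_upwards [hvl, hgl] with x h1 h2
      have h2 := ((EuclideanSpace.proj (𝕜 := ℝ) i).continuous.tendsto _).comp h2
      exact (((hcts.tendsto _).comp h1).mul h2).mul_const _
  have lim2 : Tendsto (fun n => ∫ x, |v n x| ^ p * fderiv ℝ ψ x (EuclideanSpace.single i 1)) atTop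
      (𝓝 (∫ x, |w x| ^ p * fderiv ℝ ψ x (EuclideanSpace.single i 1))) := by
    refine tendsto_integral_of_dominated_convergence
      (fun x => |g₁ x| ^ p * C') (fun n =>
        ((hpc n).mul (continuous_fderiv_apply_const hψ _)).aestronglyMeasurable)
      (hI₁.mul_const C') (fun n => ?_) ?_
    · filter_upwards [hb₁] with x h1
      rw [norm_mul, Real.norm_of_nonneg (by positivity)]
      exact mul_le_mul (Real.rpow_le_rpow (abs_nonneg _) ((h1 n).trans (le_abs_self _))
        (by linarith)) (hC' x) (norm_nonneg _) (by positivity)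
    · filter_upwards [hvl] with x h1
      exact (h1.abs.rpow_const (Or.inr (by linarith))).mul_const _
  refine tendsto_nhds_unique (lim1.const_mul p) ?_
  simp_rw [key]
  exact lim2.neg

/-- The chain rule for `|w|^p` with `w ∈ W^{1,p}_loc`, tested with a smooth function. -/
lemma integral_chain_rule {p : ℝ} (hp : 1 < p) {w : E → ℝ} {G : E → E}
    (h : HasWeakGradient w G) (hw : MemLpLoc w (ENNReal.ofReal p))
    (hG : MemLpLoc G (ENNReal.ofReal p))
    (i : Fin N) {ψ : E → ℝ} (hψ : ContDiff ℝ ∞ ψ) (hc : HasCompactSupport ψ) :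
    p * ∫ x, |w x| ^ (p - 2) * w x * G x i * ψ x =
      - ∫ x, |w x| ^ p * fderiv ℝ ψ x (EuclideanSpace.single i 1) := by
  -- Multiplying w by a cutoff equal to 1 near the support of ψ gives a global W^{1,p} function
  -- without changing either integral.
  obtain ⟨χ, hχ, hχc, hχ1⟩ := exists_cutoff (K := tsupport ψ) hc
  have key := integral_chain_rule_of_memLp hp (h.smul hχ)
    (by simpa using hw.memLp_smul hχ.continuous hχc)
    ((hG.memLp_smul hχ.continuous hχc).add
      (hw.memLp_smul' (continuous_gradient hχ) (hasCompactSupport_gradient hχc))) i hψ hc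
  have hv : ∀ x ∈ tsupport ψ, χ x = 1 ∧ gradient χ x = 0 := fun x hx => by
    refine ⟨(hχ1 x hx).eq_of_nhds, ?_⟩
    rw [gradient, (hχ1 x hx).fderiv_eq]; simp
  convert key using 2
  · refine integral_congr_ae (ae_of_all _ fun x => ?_)
    by_cases hx : x ∈ tsupport ψ
    · simp [(hv x hx).1, (hv x hx).2]
    · simp [image_eq_zero_of_notMem_tsupport hx]
  · refine integral_congr_ae (ae_of_all _ fun x => ?_)
    by_cases hx : x ∈ tsupport ψ
    · simp [(hv x hx).1]
    · have : fderiv ℝ ψ x = 0 := by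
        by_contra hne
        exact hx (support_fderiv_subset ℝ hne)
      simp [this]

end ChainRule

/-- The normalising constant of the Riesz potential. -/
noncomputable def rieszConst (N : ℕ) (α : ℝ) : ℝ :=
  Real.Gamma (((N : ℝ) - α) / 2) /
    (Real.Gamma (α / 2) * Real.pi ^ ((N : ℝ) / 2) * (2 : ℝ) ^ α)

/-! ### Enlarging the class of test functions -/

section Testing

variable {N : ℕ}

local notation "E" => EuclideanSpace ℝ (Fin N)

lemma rieszPotential_eq (α : ℝ) (x : E) :
    rieszPotential N α x = rieszConst N α * ‖x‖ ^ (-((N : ℝ) - α)) := by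
  rw [rieszPotential, rieszConst, Real.rpow_neg (norm_nonneg _), ← div_div, div_eq_mul_inv _ (‖x‖ ^ _)]

lemma memLp_abs_rpow {u : E → ℝ} {p r : ℝ} (hp : 0 < p) (hr : 0 < r)
    (hu : MemLp u (ENNReal.ofReal (r * p))) : MemLp (fun x => |u x| ^ p) (ENNReal.ofReal r) := by
  have := hu.norm_rpow_div (ENNReal.ofReal p)
  rw [ENNReal.toReal_ofReal hp.le, ENNReal.ofReal_mul hr.le,
    ENNReal.mul_div_cancel_right (by simpa using hp) ENNReal.ofReal_ne_top] at this
  simpa using this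

lemma aestronglyMeasurable_abs_rpow_mul_self {p : ℝ} (hp : 1 < p) {u : E → ℝ}
    (hu : AEStronglyMeasurable u) : AEStronglyMeasurable fun x => |u x| ^ (p - 2) * u x :=
  (continuous_abs_rpow_mul_self hp).comp_aestronglyMeasurable hu

lemma memLp_abs_rpow_mul_self_mul {u v : E → ℝ} {p r : ℝ} (hp : 1 < p) (hr : 0 < r)
    (hu : MemLp u (ENNReal.ofReal (r * p))) (hv : MemLp v (ENNReal.ofReal (r * p))) :
    MemLp (fun x => |u x| ^ (p - 2) * u x * v x) (ENNReal.ofReal r) := by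
  refine ((memLp_abs_rpow (by linarith) hr hu).add (memLp_abs_rpow (by linarith) hr hv)).mono
    ((aestronglyMeasurable_abs_rpow_mul_self hp hu.1).mul hv.1) (ae_of_all _ fun x => ?_)
  rw [Real.norm_eq_abs, Real.norm_eq_abs]
  exact (abs_rpow_mul_self_mul_le hp le_rfl le_rfl).trans (le_abs_self _)

variable {α p : ℝ}

lemma integrable_prod_riesz (hN : 1 ≤ N) (hα : 0 < α) (hαN : α < N) (hp : 1 < p)
    {u : E → ℝ} (hu : MemLp u (ENNReal.ofReal (2 * N / (N + α) * p))) {g : E → ℝ}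
    (hg : MemLp g (ENNReal.ofReal (2 * N / (N + α)))) :
    Integrable fun z : E × E => ‖z.1 - z.2‖ ^ (-((N : ℝ) - α)) * (|u z.2| ^ p * g z.1) := by
  have hN0 : (0 : ℝ) < N := by exact_mod_cast hN
  exact integrable_prod_kernel_mul hN hα hαN
    (memLp_abs_rpow (by linarith) (by positivity) hu) hg

/-- Fubini, justified by the finiteness of the Riesz energy. In the double-integral form limits can
be taken on the product space, with no estimate of the convolution itself. -/
lemma integral_choquardTerm_mul (hN : 1 ≤ N) (hα : 0 < α) (hαN : α < N) (hp : 1 < p)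
    {u v : E → ℝ} (hu : MemLp u (ENNReal.ofReal (2 * N / (N + α) * p)))
    (hv : MemLp v (ENNReal.ofReal (2 * N / (N + α) * p))) :
    ∫ x, choquardTerm α p u x * v x = rieszConst N α *
      ∫ z : E × E, ‖z.1 - z.2‖ ^ (-((N : ℝ) - α)) *
        (|u z.2| ^ p * (|u z.1| ^ (p - 2) * u z.1 * v z.1)) := by
  have hN0 : (0 : ℝ) < N := by exact_mod_cast hN
  have hi := integrable_prod_riesz hN hα hαN hp hu
    (memLp_abs_rpow_mul_self_mul hp (by positivity) hu hv)
  have := integral_prod (μ := (volume : Measure E)) (ν := (volume : Measure E)) _ hi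
  rw [Measure.volume_eq_prod, this, ← integral_const_mul]
  refine integral_congr_ae (ae_of_all _ fun x => ?_)
  simp only [choquardTerm]
  rw [convolution_eq_swap, mul_assoc, ← integral_mul_const, ← integral_const_mul]
  refine integral_congr_ae (ae_of_all _ fun y => ?_)
  simp only [ContinuousLinearMap.mul_apply', rieszPotential_eq]
  ring

/-- Mollifications of v are genuine test functions because v has compact support. The local terms
converge by L² domination; the nonlocal one is dominated through the L^q majorant of the
mollifications and the Riesz energy. -/
lemma integral_test (hN : 1 ≤ N) (hα : 0 < α) (hαN : α < N) (hp : 1 < p)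
    {u : E → ℝ} {Du : E → E} (hu : MemLp u (ENNReal.ofReal (2 * N / (N + α) * p)))
    (hu2 : MemLp u 2) (hDu2 : MemLp Du 2)
    (heq : ∀ φ : E → ℝ, ContDiff ℝ ∞ φ → HasCompactSupport φ →
      (∫ x, inner ℝ (Du x) (gradient φ x)) + ∫ x, u x * φ x = ∫ x, choquardTerm α p u x * φ x)
    {v : E → ℝ} {Gv : E → E} (hvG : HasWeakGradient v Gv) (hvc : HasCompactSupport v)
    (hv : MemLp v (ENNReal.ofReal (2 * N / (N + α) * p)))
    (hv2 : MemLp v 2) (hGv2 : MemLp Gv 2) :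
    (∫ x, inner ℝ (Du x) (Gv x)) + ∫ x, u x * v x = rieszConst N α *
      ∫ z : E × E, ‖z.1 - z.2‖ ^ (-((N : ℝ) - α)) *
        (|u z.2| ^ p * (|u z.1| ^ (p - 2) * u z.1 * v z.1)) := by
  have hN0 : (0 : ℝ) < N := by exact_mod_cast hN
  have hr : 0 < 2 * N / (N + α) := by positivity
  have hr1 : 1 ≤ 2 * N / (N + α) := by rw [le_div_iff₀ (by positivity)]; linarith
  have e2 : (2 : ℝ≥0∞) = ENNReal.ofReal 2 := by simp
  obtain ⟨w, hws, hwc, hwl, hgl, ⟨g₁, hg₁, hb₁⟩, ⟨g₂, hg₂, hb₂⟩, ⟨g₃, hg₃, hb₃⟩⟩ :=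
    exists_smooth_approx hvG (s₁ := 2) (s₂ := 2 * N / (N + α) * p) (s₃ := 2) (by norm_num)
      (by nlinarith) (by norm_num) (e2 ▸ hv2) hv (e2 ▸ hGv2)
  rw [← e2] at hg₁ hg₃
  have hwc := hwc hvc
  have key := fun n => heq (w n) (hws n) (hwc n)
  have hwq : ∀ n, MemLp (w n) (ENNReal.ofReal (2 * N / (N + α) * p)) := fun n =>
    (hws n).continuous.memLp_of_hasCompactSupport (hwc n)
  simp_rw [fun n => integral_choquardTerm_mul hN hα hαN hp hu (hwq n)] at key
  have lim1 : Tendsto (fun n => ∫ x, inner ℝ (Du x) (gradient (w n) x)) atTop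
      (𝓝 (∫ x, inner ℝ (Du x) (Gv x))) := by
    refine tendsto_integral_of_dominated_convergence (fun x => ‖Du x‖ * g₃ x)
      (fun n => hDu2.1.inner (continuous_gradient (hws n)).aestronglyMeasurable)
      (hDu2.norm.integrable_mul hg₃) (fun n => ?_) ?_
    · filter_upwards [hb₃] with x h3
      exact (norm_inner_le_norm _ _).trans (by gcongr; exact h3 n)
    · filter_upwards [hgl] with x h
      exact tendsto_const_nhds.inner h
  have lim2 : Tendsto (fun n => ∫ x, u x * w n x) atTop (𝓝 (∫ x, u x * v x)) := by
    refine tendsto_integral_of_dominated_convergence (fun x => ‖u x‖ * g₁ x)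
      (fun n => hu2.1.mul (hws n).continuous.aestronglyMeasurable)
      (hu2.norm.integrable_mul hg₁) (fun n => ?_) ?_
    · filter_upwards [hb₁] with x h1
      rw [norm_mul]; gcongr; exact h1 n
    · filter_upwards [hwl] with x h
      exact h.const_mul _
  have lim3 : Tendsto (fun n => ∫ z : E × E, ‖z.1 - z.2‖ ^ (-((N : ℝ) - α)) *
        (|u z.2| ^ p * (|u z.1| ^ (p - 2) * u z.1 * w n z.1))) atTop
      (𝓝 (∫ z : E × E, ‖z.1 - z.2‖ ^ (-((N : ℝ) - α)) *
        (|u z.2| ^ p * (|u z.1| ^ (p - 2) * u z.1 * v z.1)))) := by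
    refine tendsto_integral_of_dominated_convergence (fun z => ‖z.1 - z.2‖ ^ (-((N : ℝ) - α)) *
        (|u z.2| ^ p * (|u z.1| ^ p + |g₂ z.1| ^ p))) (fun n => ?_) ?_ (fun n => ?_) ?_
    · exact (integrable_prod_riesz hN hα hαN hp hu
        (memLp_abs_rpow_mul_self_mul hp hr hu (hwq n))).1
    · exact integrable_prod_riesz hN hα hαN hp hu
        ((memLp_abs_rpow (by linarith) hr hu).add (memLp_abs_rpow (by linarith) hr hg₂))
    · have hb : ∀ᵐ z : E × E, ∀ n, ‖w n z.1‖ ≤ g₂ z.1 :=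
        Measure.quasiMeasurePreserving_fst.ae hb₂
      filter_upwards [hb] with z h2
      rw [norm_mul, norm_mul, Real.norm_of_nonneg (by positivity),
        Real.norm_of_nonneg (by positivity)]
      gcongr
      exact abs_rpow_mul_self_mul_le hp le_rfl ((h2 n).trans (le_abs_self _))
    · have hb : ∀ᵐ z : E × E, Tendsto (fun n => w n z.1) atTop (𝓝 (v z.1)) :=
        Measure.quasiMeasurePreserving_fst.ae hwl
      filter_upwards [hb] with z h
      exact ((h.const_mul _).const_mul _).const_mul _
  exact tendsto_nhds_unique ((lim1.add lim2).congr key) (lim3.const_mul _)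

end Testing

/-! ### Integration by parts against the Riesz kernel -/

section Kernel

variable {N : ℕ}

local notation "E" => EuclideanSpace ℝ (Fin N)

/-- The smooth regularisation `(|x|² + e²)^(-s/2)` of `|x|^(-s)`. -/
noncomputable def regKernel (s e : ℝ) (x : EuclideanSpace ℝ (Fin N)) : ℝ :=
  (‖x‖ ^ 2 + e ^ 2) ^ (-s / 2)

/-- The factor produced by integrating `ξ(x) k(x - y)` by parts in the direction `i` and
symmetrising, where `k(x) = (|x|² + e²)^(-s/2)`. -/
noncomputable def dilationWeight (s e : ℝ) (i : Fin N) (ξ : EuclideanSpace ℝ (Fin N) → ℝ)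
    (z : EuclideanSpace ℝ (Fin N) × EuclideanSpace ℝ (Fin N)) : ℝ :=
  fderiv ℝ ξ z.1 (EuclideanSpace.single i 1) -
    s / 2 * ((z.1 - z.2) i * (ξ z.1 - ξ z.2) / (‖z.1 - z.2‖ ^ 2 + e ^ 2))

lemma regKernel_nonneg (s e : ℝ) (x : E) : 0 ≤ regKernel s e x := by
  unfold regKernel; positivity

lemma regKernel_zero_right (s : ℝ) (x : E) : regKernel s 0 x = ‖x‖ ^ (-s) := by
  rw [regKernel, zero_pow two_ne_zero, add_zero, ← Real.rpow_natCast, ← Real.rpow_mul (norm_nonneg _)]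
  congr 1; push_cast; ring

/-- The origin is excluded because there `0 ^ (-s)` is 0 for s > 0, not infinity. This is why later
comparisons hold only off the diagonal, a null set. -/
lemma regKernel_le {s : ℝ} (hs : 0 < s) (e : ℝ) {x : E} (hx : x ≠ 0) :
    regKernel s e x ≤ ‖x‖ ^ (-s) := by
  have hx : 0 < ‖x‖ := norm_pos_iff.2 hx
  rw [← regKernel_zero_right, regKernel, regKernel]
  apply Real.rpow_le_rpow_of_nonpos (by positivity) _ (by linarith)
  nlinarith [sq_nonneg e]

lemma tendsto_regKernel (s : ℝ) {x : E} (hx : x ≠ 0) {e : ℕ → ℝ} (he : Tendsto e atTop (𝓝 0)) :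
    Tendsto (fun n => regKernel s (e n) x) atTop (𝓝 (‖x‖ ^ (-s))) := by
  have hx : 0 < ‖x‖ := norm_pos_iff.2 hx
  rw [← regKernel_zero_right]
  exact ((he.pow 2).const_add _).rpow_const (Or.inl (by positivity))

lemma contDiff_regKernel (s : ℝ) {e : ℝ} (he : 0 < e) : ContDiff ℝ ∞ (regKernel (N := N) s e) := by
  refine ContDiff.rpow_const_of_ne ?_ fun x => by positivity
  exact (contDiff_norm_sq ℝ).add contDiff_const

lemma fderiv_regKernel (s : ℝ) {e : ℝ} (he : 0 < e) (x : E) (i : Fin N) :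
    fderiv ℝ (regKernel s e) x (EuclideanSpace.single i 1) =
      -s * (x i * regKernel s e x / (‖x‖ ^ 2 + e ^ 2)) := by
  have hpos : 0 < ‖x‖ ^ 2 + e ^ 2 := by positivity
  have h1 : HasFDerivAt (fun x : E => ‖x‖ ^ 2 + e ^ 2) (2 • innerSL ℝ x) x := by
    simpa using (hasStrictFDerivAt_norm_sq x).hasFDerivAt.add_const (e ^ 2)
  have h2 := (Real.hasDerivAt_rpow_const (p := -s / 2) (Or.inl hpos.ne')).comp_hasFDerivAt x h1
  have h3 : fderiv ℝ (regKernel s e) x = _ := h2.fderiv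
  rw [h3, regKernel]
  have h4 : (‖x‖ ^ 2 + e ^ 2) ^ (-s / 2 - 1) = (‖x‖ ^ 2 + e ^ 2) ^ (-s / 2) / (‖x‖ ^ 2 + e ^ 2) :=
    Real.rpow_sub_one hpos.ne' _
  simp [h4, EuclideanSpace.inner_single_right]
  ring

lemma ae_prod_ne (hN : 1 ≤ N) : ∀ᵐ z : E × E, z.1 - z.2 ≠ 0 := by
  have : Nonempty (Fin N) := ⟨⟨0, hN⟩⟩
  have hm : MeasurableSet {z : E × E | ¬ z.1 - z.2 ≠ 0} := by
    have : {z : E × E | ¬ z.1 - z.2 ≠ 0} = (fun z : E × E => z.1 - z.2) ⁻¹' {0} := by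
      ext; simp
    rw [this]
    exact (measurable_fst.sub measurable_snd) (measurableSet_singleton 0)
  rw [ae_iff, Measure.volume_eq_prod, Measure.measure_prod_null hm]
  refine ae_of_all _ fun x => ?_
  have : Prod.mk x ⁻¹' {z : E × E | ¬ z.1 - z.2 ≠ 0} = {x} := by
    ext y; simp [sub_eq_zero, eq_comm]
  change volume (Prod.mk x ⁻¹' _) = 0
  rw [this]; simp

/-- The functions t⁻¹ξ(t·) share the Lipschitz constant of ξ and its derivative bound. The
difference of values therefore gains a factor |x - y|, which absorbs the quotient. Uniformity in e
serves the removal of the regularisation, uniformity in t the dilation limit. -/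
lemma exists_dilationWeight_bound {ξ : E → ℝ} (hξ : ContDiff ℝ ∞ ξ) (hc : HasCompactSupport ξ)
    {s : ℝ} (hs : 0 ≤ s) (i : Fin N) :
    ∃ C : ℝ, ∀ (t e : ℝ) (z : E × E), 0 < t →
      ‖dilationWeight s e i (fun x => t⁻¹ * ξ (t • x)) z‖ ≤ C := by
  obtain ⟨C, hC⟩ := (continuous_fderiv_apply_const hξ
    (EuclideanSpace.single i 1)).bounded_above_of_compact_support (hasCompactSupport_fderiv_apply hc _)
  obtain ⟨L, hL⟩ := hξ.lipschitzWith_of_hasCompactSupport hc (by simp)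
  refine ⟨C + s / 2 * L, fun t e z ht => ?_⟩
  have hfd : fderiv ℝ (fun x => t⁻¹ * ξ (t • x)) z.1 (EuclideanSpace.single i 1) =
      fderiv ℝ ξ (t • z.1) (EuclideanSpace.single i 1) := by
    rw [fderiv_const_mul, fderiv_comp_smul]
    · simp [ht.ne']
    · exact (hξ.differentiable (by simp)).comp (differentiable_id.const_smul t) _
  rw [dilationWeight, hfd]
  refine (norm_sub_le _ _).trans (add_le_add (hC _) ?_)
  rw [norm_mul, Real.norm_of_nonneg (by positivity : 0 ≤ s / 2)]
  gcongr
  rw [norm_div, norm_mul, Real.norm_of_nonneg (by positivity : 0 ≤ ‖z.1 - z.2‖ ^ 2 + e ^ 2)]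
  refine div_le_of_le_mul₀ (by positivity) (by positivity) ?_
  have h1 : ‖(z.1 - z.2) i‖ ≤ ‖z.1 - z.2‖ := PiLp.norm_apply_le _ i
  have h2 : ‖t⁻¹ * ξ (t • z.1) - t⁻¹ * ξ (t • z.2)‖ ≤ L * ‖z.1 - z.2‖ := by
    rw [← mul_sub, norm_mul, Real.norm_of_nonneg (by positivity)]
    have := hL.dist_le_mul (t • z.1) (t • z.2)
    rw [dist_eq_norm, dist_eq_norm, ← smul_sub, norm_smul, Real.norm_of_nonneg ht.le] at this
    calc _ ≤ t⁻¹ * (L * (t * ‖z.1 - z.2‖)) := by gcongr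
      _ = _ := by field_simp
  calc _ ≤ ‖z.1 - z.2‖ * (L * ‖z.1 - z.2‖) := by gcongr
    _ = L * ‖z.1 - z.2‖ ^ 2 := by ring
    _ ≤ L * (‖z.1 - z.2‖ ^ 2 + e ^ 2) := by gcongr; nlinarith [sq_nonneg e]

lemma measurable_dilationWeight {ξ : E → ℝ} (hξ : ContDiff ℝ ∞ ξ) (s e : ℝ) (i : Fin N) :
    Measurable (dilationWeight s e i ξ) := by
  have h1 := (continuous_fderiv_apply_const hξ (EuclideanSpace.single i 1)).measurable
  have h2 := hξ.continuous.measurable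
  have h3 : Measurable fun z : E × E => (z.1 - z.2) i :=
    (EuclideanSpace.proj (𝕜 := ℝ) i).measurable.comp (measurable_fst.sub measurable_snd)
  unfold dilationWeight
  refine (h1.comp measurable_fst).sub (Measurable.const_mul ?_ _)
  refine (h3.mul ((h2.comp measurable_fst).sub (h2.comp measurable_snd))).div ?_
  fun_prop

variable {α p : ℝ}

/-- For fixed y, the function x ↦ k(x - y)ξ(x) is smooth with compact support, so the chain rule for
|u|^p applies; this is the purpose of e > 0. The term carrying ∂ᵢk is then averaged with its image
under exchanging x and y, and oddness of ∂ᵢk produces ξ(x) - ξ(y). -/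
lemma integral_regKernel_mul_gradient (hN : 1 ≤ N) (hα : 0 < α) (hαN : α < N) (hp : 1 < p)
    {u : E → ℝ} {Du : E → E} (hu : MemLp u (ENNReal.ofReal (2 * N / (N + α) * p)))
    (hDu : HasWeakGradient u Du) (hDuq : MemLpLoc Du (ENNReal.ofReal (2 * N / (N + α) * p)))
    (i : Fin N) {ξ : E → ℝ} (hξ : ContDiff ℝ ∞ ξ) (hc : HasCompactSupport ξ) {e : ℝ} (he : 0 < e) :
    p * ∫ z : E × E, regKernel (N - α) e (z.1 - z.2) *
        (|u z.2| ^ p * (|u z.1| ^ (p - 2) * u z.1 * (ξ z.1 * Du z.1 i))) =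
      - ∫ z : E × E, regKernel (N - α) e (z.1 - z.2) *
        (|u z.2| ^ p * |u z.1| ^ p * dilationWeight (N - α) e i ξ z) := by
  have hN0 : (0 : ℝ) < N := by exact_mod_cast hN
  have hr : 0 < 2 * N / (N + α) := by positivity
  have hr1 : 1 ≤ 2 * N / (N + α) := by rw [le_div_iff₀ (by positivity)]; linarith
  have hs : 0 < (N : ℝ) - α := by linarith
  set k : E → ℝ := regKernel (N - α) e with hk
  have hks : ContDiff ℝ ∞ k := contDiff_regKernel _ he
  have hv : MemLp (fun x => ξ x * Du x i) (ENNReal.ofReal (2 * N / (N + α) * p)) :=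
    (hDuq.coord i).memLp_smul hξ.continuous hc
  have hmeas : ∀ {F : E → ℝ}, Continuous F →
      AEStronglyMeasurable (fun z : E × E => F (z.1 - z.2)) volume := fun hF =>
    (hF.comp (continuous_fst.sub continuous_snd)).aestronglyMeasurable
  have hbound : ∀ (a b : E → ℝ), MemLp b (ENNReal.ofReal (2 * N / (N + α))) → Continuous a →
      (∃ C, ∀ x, ‖a x‖ ≤ C * k x) →
      Integrable fun z : E × E => a (z.1 - z.2) * (|u z.2| ^ p * b z.1) := by
    intro a b hb ha ⟨C, hC⟩
    have h0 := integrable_prod_riesz hN hα hαN hp hu hb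
    have hmu : AEStronglyMeasurable (fun z : E × E => |u z.2| ^ p * b z.1) volume :=
      ((memLp_abs_rpow (by linarith) hr hu).1.comp_quasiMeasurePreserving
        Measure.quasiMeasurePreserving_snd).mul
        (hb.1.comp_quasiMeasurePreserving Measure.quasiMeasurePreserving_fst)
    refine Integrable.mono' (h0.norm.const_mul C) ((hmeas ha).mul hmu) ?_
    filter_upwards [ae_prod_ne hN] with z hz
    have hC0 : 0 ≤ C := by
      have h1 := (norm_nonneg _).trans (hC 0)
      have h2 : 0 < k 0 := by rw [hk, regKernel]; positivity
      exact nonneg_of_mul_nonneg_left h1 h2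
    rw [norm_mul, norm_mul (‖z.1 - z.2‖ ^ (-((N : ℝ) - α))), Real.norm_of_nonneg (by positivity : 0 ≤ ‖z.1 - z.2‖ ^ (-((N : ℝ) - α))),
      ← mul_assoc]
    gcongr
    exact (hC _).trans (by gcongr; exact regKernel_le hs e hz)
  have hkbd : ∃ C, ∀ x, ‖k x‖ ≤ C * k x := ⟨1, fun x => by
    rw [one_mul, Real.norm_of_nonneg (regKernel_nonneg _ _ _)]⟩
  have hfp : MemLp (fun x => |u x| ^ p) (ENNReal.ofReal (2 * N / (N + α))) :=
    memLp_abs_rpow (by linarith) hr hu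
  set k' : E → ℝ := fun x => fderiv ℝ k x (EuclideanSpace.single i 1) with hk'
  have hk'c : Continuous k' := continuous_fderiv_apply_const hks _
  have hk'e : ∀ x, k' x = -((N : ℝ) - α) * (x i * k x / (‖x‖ ^ 2 + e ^ 2)) := fun x =>
    fderiv_regKernel _ he x i
  have hk'bd : ∃ C, ∀ x, ‖k' x‖ ≤ C * k x := by
    -- From |x| e ≤ |x|² + e². The constant blows up as e → 0, which is harmless here: the bound
    -- only splits integrals at fixed e, and the symmetrised weight has a bound independent of e.
    refine ⟨((N : ℝ) - α) / e, fun x => ?_⟩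
    have hkn : 0 ≤ k x := regKernel_nonneg _ _ _
    have hx : ‖x i‖ ≤ ‖x‖ := PiLp.norm_apply_le _ i
    have h1 : ‖x i‖ / (‖x‖ ^ 2 + e ^ 2) ≤ 1 / e := by
      rw [div_le_div_iff₀ (by positivity) he]
      have : ‖x i‖ * e ≤ ‖x‖ * e := by gcongr
      nlinarith [sq_nonneg (‖x‖ - e), norm_nonneg x]
    rw [hk'e, norm_mul, norm_neg, Real.norm_of_nonneg hs.le, norm_div, norm_mul,
      Real.norm_of_nonneg hkn, Real.norm_of_nonneg (by positivity : 0 ≤ ‖x‖ ^ 2 + e ^ 2)]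
    calc _ = ((N : ℝ) - α) * k x * (‖x i‖ / (‖x‖ ^ 2 + e ^ 2)) := by ring
      _ ≤ ((N : ℝ) - α) * k x * (1 / e) := by gcongr
      _ = _ := by ring
  have hξ' : MemLp (fun x => |u x| ^ p * fderiv ℝ ξ x (EuclideanSpace.single i 1))
      (ENNReal.ofReal (2 * N / (N + α))) := by
    simp_rw [mul_comm (|u _| ^ p)]
    exact (memLpLoc_of_memLp hfp).memLp_smul (continuous_fderiv_apply_const hξ _)
      (hasCompactSupport_fderiv_apply hc _)
  have hξu : MemLp (fun x => |u x| ^ p * ξ x) (ENNReal.ofReal (2 * N / (N + α))) := by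
    simp_rw [mul_comm (|u _| ^ p)]
    exact (memLpLoc_of_memLp hfp).memLp_smul hξ.continuous hc
  have hI₁ := hbound k _ (memLp_abs_rpow_mul_self_mul hp hr hu hv) hks.continuous hkbd
  have hI₂ := hbound k _ hξ' hks.continuous hkbd
  have hI₃ := hbound k' _ hξu hk'c hk'bd
  have hI₄ : Integrable fun z : E × E => k' (z.2 - z.1) * (|u z.1| ^ p * (|u z.2| ^ p * ξ z.2)) :=
    hI₃.swap
  have hI₅ : Integrable fun z : E × E =>
      2⁻¹ * (k' (z.1 - z.2) * (|u z.2| ^ p * (|u z.1| ^ p * ξ z.1))) +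
        2⁻¹ * (k' (z.2 - z.1) * (|u z.1| ^ p * (|u z.2| ^ p * ξ z.2))) :=
    (hI₃.const_mul _).add (hI₄.const_mul _)
  have hchain : ∀ y, p * ∫ x, k (x - y) * (|u y| ^ p * (|u x| ^ (p - 2) * u x * (ξ x * Du x i))) =
      - ∫ x, (k (x - y) * (|u y| ^ p * (|u x| ^ p * fderiv ℝ ξ x (EuclideanSpace.single i 1))) +
        k' (x - y) * (|u y| ^ p * (|u x| ^ p * ξ x))) := fun y => by
    have hψ : ContDiff ℝ ∞ fun x => k (x - y) * ξ x :=
      (hks.comp (contDiff_id.sub contDiff_const)).mul hξ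
    -- Since 2N/(N+α) ≥ 1, local L^q integrability implies the local L^p integrability required by
    -- the chain rule.
    have hpq : ENNReal.ofReal p ≤ ENNReal.ofReal (2 * N / (N + α) * p) :=
      ENNReal.ofReal_le_ofReal (by nlinarith)
    have h := integral_chain_rule hp hDu ((memLpLoc_of_memLp hu).mono_exponent hpq)
      (hDuq.mono_exponent hpq) i hψ hc.mul_left
    have hfd : ∀ x, fderiv ℝ (fun x => k (x - y) * ξ x) x (EuclideanSpace.single i 1) =
        k (x - y) * fderiv ℝ ξ x (EuclideanSpace.single i 1) + ξ x * k' (x - y) := fun x => by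
      have hd : HasFDerivAt (fun x => k (x - y)) (fderiv ℝ k (x - y)) x := by
        exact (hasFDerivAt_comp_sub y).2 (hks.differentiable (by simp) (x - y)).hasFDerivAt
      have hd2 := hd.mul (hξ.differentiable (by simp) x).hasFDerivAt
      have hd3 : fderiv ℝ (fun x => k (x - y) * ξ x) x = _ := hd2.fderiv
      rw [hd3]; rfl
    have l₁ : ∫ x, k (x - y) * (|u y| ^ p * (|u x| ^ (p - 2) * u x * (ξ x * Du x i))) =
        |u y| ^ p * ∫ x, |u x| ^ (p - 2) * u x * Du x i * (k (x - y) * ξ x) := by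
      rw [← integral_const_mul]; congr 1; ext x; ring
    have l₂ : ∫ x, (k (x - y) * (|u y| ^ p *
          (|u x| ^ p * fderiv ℝ ξ x (EuclideanSpace.single i 1))) +
        k' (x - y) * (|u y| ^ p * (|u x| ^ p * ξ x))) = |u y| ^ p * ∫ x, |u x| ^ p *
          fderiv ℝ (fun x => k (x - y) * ξ x) x (EuclideanSpace.single i 1) := by
      rw [← integral_const_mul]; congr 1; ext x; rw [hfd]; ring
    rw [l₁, l₂, mul_left_comm, h, mul_neg]
  have hL := integral_prod_symm (μ := (volume : Measure E)) (ν := (volume : Measure E)) _ hI₁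
  have hR := integral_prod_symm (μ := (volume : Measure E)) (ν := (volume : Measure E)) _
    (hI₂.add hI₃)
  have hsum : p * (∫ z : E × E, k (z.1 - z.2) *
        (|u z.2| ^ p * (|u z.1| ^ (p - 2) * u z.1 * (ξ z.1 * Du z.1 i)))) =
      - ∫ z : E × E, (k (z.1 - z.2) *
          (|u z.2| ^ p * (|u z.1| ^ p * fderiv ℝ ξ z.1 (EuclideanSpace.single i 1))) +
        k' (z.1 - z.2) * (|u z.2| ^ p * (|u z.1| ^ p * ξ z.1))) := by
    rw [Measure.volume_eq_prod, hL, ← integral_const_mul]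
    simp_rw [hchain]
    rw [integral_neg]
    exact congrArg _ hR.symm
  have hswap : ∫ z : E × E, k' (z.1 - z.2) * (|u z.2| ^ p * (|u z.1| ^ p * ξ z.1)) =
      ∫ z : E × E, k' (z.2 - z.1) * (|u z.1| ^ p * (|u z.2| ^ p * ξ z.2)) :=
    (integral_prod_swap (μ := (volume : Measure E)) (ν := (volume : Measure E))
      (fun z : E × E => k' (z.1 - z.2) * (|u z.2| ^ p * (|u z.1| ^ p * ξ z.1)))).symm
  rw [hsum, integral_add hI₂ hI₃]
  have hhalf : ∫ z : E × E, k' (z.1 - z.2) * (|u z.2| ^ p * (|u z.1| ^ p * ξ z.1)) =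
      ∫ z : E × E, (2⁻¹ * (k' (z.1 - z.2) * (|u z.2| ^ p * (|u z.1| ^ p * ξ z.1))) +
        2⁻¹ * (k' (z.2 - z.1) * (|u z.1| ^ p * (|u z.2| ^ p * ξ z.2)))) := by
    rw [integral_add (hI₃.const_mul _) (hI₄.const_mul _), integral_const_mul, integral_const_mul]
    rw [← hswap]; ring
  rw [hhalf, ← integral_add hI₂ hI₅]
  refine congrArg _ (integral_congr_ae (ae_of_all _ fun z => ?_))
  have hodd : k' (z.2 - z.1) = - k' (z.1 - z.2) := by
    rw [hk'e, hk'e, ← neg_sub z.1 z.2, norm_neg]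
    have : k (-(z.1 - z.2)) = k (z.1 - z.2) := by rw [hk, regKernel, regKernel, norm_neg]
    rw [this]; simp only [PiLp.neg_apply]; ring
  simp only [hodd, hk'e (z.1 - z.2), dilationWeight]
  ring

/-- Limit e → 0 in the regularised identity. Both sides are dominated by Riesz energies: the
regularised kernel lies below the Riesz kernel and the weights are bounded uniformly in e. -/
lemma integral_riesz_mul_gradient (hN : 1 ≤ N) (hα : 0 < α) (hαN : α < N) (hp : 1 < p)
    {u : E → ℝ} {Du : E → E} (hu : MemLp u (ENNReal.ofReal (2 * N / (N + α) * p)))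
    (hDu : HasWeakGradient u Du) (hDuq : MemLpLoc Du (ENNReal.ofReal (2 * N / (N + α) * p)))
    (i : Fin N) {ξ : E → ℝ} (hξ : ContDiff ℝ ∞ ξ) (hc : HasCompactSupport ξ) :
    p * ∫ z : E × E, ‖z.1 - z.2‖ ^ (-((N : ℝ) - α)) *
        (|u z.2| ^ p * (|u z.1| ^ (p - 2) * u z.1 * (ξ z.1 * Du z.1 i))) =
      - ∫ z : E × E, ‖z.1 - z.2‖ ^ (-((N : ℝ) - α)) *
        (|u z.2| ^ p * |u z.1| ^ p * dilationWeight (N - α) 0 i ξ z) := by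
  have hN0 : (0 : ℝ) < N := by exact_mod_cast hN
  have hr : 0 < 2 * N / (N + α) := by positivity
  have hs : 0 < (N : ℝ) - α := by linarith
  have hv : MemLp (fun x => ξ x * Du x i) (ENNReal.ofReal (2 * N / (N + α) * p)) :=
    (hDuq.coord i).memLp_smul hξ.continuous hc
  have hfp : MemLp (fun x => |u x| ^ p) (ENNReal.ofReal (2 * N / (N + α))) :=
    memLp_abs_rpow (by linarith) hr hu
  have hI₁ := integrable_prod_riesz hN hα hαN hp hu (memLp_abs_rpow_mul_self_mul hp hr hu hv)
  have hI₂ := integrable_prod_riesz hN hα hαN hp hu hfp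
  obtain ⟨C, hC⟩ := exists_dilationWeight_bound hξ hc hs.le i
  have hC : ∀ e z, ‖dilationWeight (N - α) e i ξ z‖ ≤ C := fun e z => by
    simpa using hC 1 e z one_pos
  let e : ℕ → ℝ := fun n => 1 / ((n : ℝ) + 1)
  have he : ∀ n, 0 < e n := fun n => by positivity
  have helim : Tendsto e atTop (𝓝 0) := tendsto_one_div_add_atTop_nhds_zero_nat
  have hkm : ∀ n, AEStronglyMeasurable (fun z : E × E => regKernel (N - α) (e n) (z.1 - z.2)) :=
    fun n => ((contDiff_regKernel _ (he n)).continuous.comp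
      (continuous_fst.sub continuous_snd)).aestronglyMeasurable
  have hu2 := hfp.1.comp_quasiMeasurePreserving
    (Measure.quasiMeasurePreserving_snd (μ := (volume : Measure E)) (ν := (volume : Measure E)))
  have hu1 := hfp.1.comp_quasiMeasurePreserving
    (Measure.quasiMeasurePreserving_fst (μ := (volume : Measure E)) (ν := (volume : Measure E)))
  have hv1 := (memLp_abs_rpow_mul_self_mul hp hr hu hv).1.comp_quasiMeasurePreserving
    (Measure.quasiMeasurePreserving_fst (μ := (volume : Measure E)) (ν := (volume : Measure E)))
  have lim1 : Tendsto (fun n => ∫ z : E × E, regKernel (N - α) (e n) (z.1 - z.2) *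
        (|u z.2| ^ p * (|u z.1| ^ (p - 2) * u z.1 * (ξ z.1 * Du z.1 i)))) atTop
      (𝓝 (∫ z : E × E, ‖z.1 - z.2‖ ^ (-((N : ℝ) - α)) *
        (|u z.2| ^ p * (|u z.1| ^ (p - 2) * u z.1 * (ξ z.1 * Du z.1 i))))) := by
    refine tendsto_integral_of_dominated_convergence _ (fun n => (hkm n).mul (hu2.mul hv1))
      hI₁.norm (fun n => ?_) ?_
    · filter_upwards [ae_prod_ne hN] with z hz
      rw [norm_mul, norm_mul (‖z.1 - z.2‖ ^ (-((N : ℝ) - α))), Real.norm_of_nonneg (regKernel_nonneg _ _ _), Real.norm_of_nonneg (by positivity : 0 ≤ ‖z.1 - z.2‖ ^ (-((N : ℝ) - α)))]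
      gcongr
      exact regKernel_le hs _ hz
    · filter_upwards [ae_prod_ne hN] with z hz
      exact (tendsto_regKernel _ hz helim).mul_const _
  have lim2 : Tendsto (fun n => ∫ z : E × E, regKernel (N - α) (e n) (z.1 - z.2) *
        (|u z.2| ^ p * |u z.1| ^ p * dilationWeight (N - α) (e n) i ξ z)) atTop
      (𝓝 (∫ z : E × E, ‖z.1 - z.2‖ ^ (-((N : ℝ) - α)) *
        (|u z.2| ^ p * |u z.1| ^ p * dilationWeight (N - α) 0 i ξ z))) := by
    refine tendsto_integral_of_dominated_convergence _ (fun n => (hkm n).mul ((hu2.mul hu1).mul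
      (measurable_dilationWeight hξ _ _ _).aestronglyMeasurable))
      (hI₂.norm.mul_const C) (fun n => ?_) ?_
    · filter_upwards [ae_prod_ne hN] with z hz
      simp only [norm_mul]
      rw [Real.norm_of_nonneg (regKernel_nonneg _ _ _),
        Real.norm_of_nonneg (by positivity : 0 ≤ ‖z.1 - z.2‖ ^ (-((N : ℝ) - α))), mul_assoc (‖z.1 - z.2‖ ^ (-((N : ℝ) - α)))]
      gcongr
      · exact regKernel_le hs _ hz
      · exact hC _ _
    · filter_upwards [ae_prod_ne hN] with z hz
      refine (tendsto_regKernel _ hz helim).mul (Tendsto.const_mul _ ?_)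
      have hz' : 0 < ‖z.1 - z.2‖ := norm_pos_iff.2 hz
      refine Tendsto.const_sub _ (Tendsto.const_mul _ (Tendsto.div tendsto_const_nhds ?_ ?_))
      · exact (helim.pow 2).const_add _
      · positivity
  refine tendsto_nhds_unique (lim1.const_mul p) ?_
  simp_rw [fun n => integral_regKernel_mul_gradient hN hα hαN hp hu hDu hDuq i hξ hc (he n)]
  exact lim2.neg

end Kernel

/-! ### The Pohozaev and Nehari identities -/

section Pohozaev

variable {N : ℕ}

local notation "E" => EuclideanSpace ℝ (Fin N)

/-- Both sides pair with φ as the integral of u against a mixed second derivative of φ, and those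
commute. -/
lemma ae_eq_second_weak_derivatives {u : E → ℝ} {Du : E → E} {H : Fin N → E → E}
    (hDu : HasWeakGradient u Du) (hH : ∀ i, HasWeakGradient (fun x => Du x i) (H i))
    (i j : Fin N) : ∀ᵐ x, H i x j = H j x i := by
  have hd : ∀ (φ : E → ℝ), ContDiff ℝ ∞ φ → ∀ (k : Fin N),
      ContDiff ℝ ∞ fun x => fderiv ℝ φ x (EuclideanSpace.single k 1) := fun φ hφ k =>
    (hφ.fderiv_right (m := ∞) (by simp)).clm_apply contDiff_const
  have hdd : ∀ (φ : E → ℝ), ContDiff ℝ ∞ φ → ∀ (k l : Fin N) (x : E),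
      fderiv ℝ (fun x => fderiv ℝ φ x (EuclideanSpace.single k 1)) x (EuclideanSpace.single l 1) =
        fderiv ℝ (fderiv ℝ φ) x (EuclideanSpace.single l 1) (EuclideanSpace.single k 1) :=
    fun φ hφ k l x => by
      have h1 : DifferentiableAt ℝ (fderiv ℝ φ) x :=
        (hφ.fderiv_right (m := ∞) (by simp)).differentiable (by simp) x
      rw [fderiv_clm_apply h1 (differentiableAt_const _)]
      simp
  refine ae_eq_of_integral_contDiff_smul_eq (locallyIntegrable_coord (hH i).2.1 j)
    (locallyIntegrable_coord (hH j).2.1 i) fun φ hφ hc => ?_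
  have a1 := (hH i).2.2 j φ hφ hc
  have a2 := (hH j).2.2 i φ hφ hc
  have a3 := hDu.2.2 i _ (hd φ hφ j) (hasCompactSupport_fderiv_apply hc _)
  have a4 := hDu.2.2 j _ (hd φ hφ i) (hasCompactSupport_fderiv_apply hc _)
  have a5 : ∀ x, fderiv ℝ (fun x => fderiv ℝ φ x (EuclideanSpace.single j 1)) x
      (EuclideanSpace.single i 1) = fderiv ℝ (fun x => fderiv ℝ φ x (EuclideanSpace.single i 1)) x
      (EuclideanSpace.single j 1) := fun x => by
    rw [hdd φ hφ, hdd φ hφ]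
    exact (hφ.contDiffAt.isSymmSndFDerivAt
      (by rw [minSmoothness_of_isRCLikeNormedField]
          exact (WithTop.coe_le_coe.2 le_top : ((2 : ℕ∞) : WithTop ℕ∞) ≤ _))).eq _ _
  simp_rw [a5] at a3
  simp only [smul_eq_mul, mul_comm (φ _)]
  linarith

lemma integrable_inner_of_memLp {f g : E → E} (hf : MemLp f 2) (hg : MemLp g 2) :
    Integrable fun x => inner ℝ (f x) (g x) :=
  (hf.norm.integrable_mul hg.norm).mono' (hf.1.inner hg.1)
    (ae_of_all _ fun _ => norm_inner_le_norm _ _)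

/-- The chain rule with exponent 2: w ∂ᵢw is the derivative of w²/2. -/
lemma integral_mul_weak_derivative {w : E → ℝ} {G : E → E} (h : HasWeakGradient w G)
    (hw : MemLpLoc w 2) (hG : MemLpLoc G 2) (i : Fin N) {ξ : E → ℝ} (hξ : ContDiff ℝ ∞ ξ)
    (hc : HasCompactSupport ξ) :
    ∫ x, w x * G x i * ξ x =
      -(2⁻¹ * ∫ x, w x ^ 2 * fderiv ℝ ξ x (EuclideanSpace.single i 1)) := by
  have e2 : (2 : ℝ≥0∞) = ENNReal.ofReal 2 := by simp
  have := integral_chain_rule one_lt_two h (e2 ▸ hw) (e2 ▸ hG) i hξ hc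
  simp only [sub_self, Real.rpow_zero, one_mul, Real.rpow_two, sq_abs] at this
  linarith

variable {α p : ℝ}

/-- The equation is tested with ξ ∂ᵢu, whose gradient is ξ ∇∂ᵢu + ∂ᵢu ∇ξ. The products ∇u·∇∂ᵢu and u
∂ᵢu are derivatives of |∇u|²/2 and u²/2, so every derivative beyond the first moves onto ξ. -/
lemma pohozaev_local (hN : 1 ≤ N) (hα : 0 < α) (hαN : α < N) (hp : 1 < p)
    {u : E → ℝ} {Du : E → E} {H : Fin N → E → E}
    (hu : MemLp u (ENNReal.ofReal (2 * N / (N + α) * p)))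
    (hu2 : MemLp u 2) (hDu2 : MemLp Du 2) (hDu : HasWeakGradient u Du)
    (hDuq : MemLpLoc Du (ENNReal.ofReal (2 * N / (N + α) * p)))
    (hH : ∀ i, HasWeakGradient (fun x => Du x i) (H i)) (hH2 : ∀ i, MemLpLoc (H i) 2)
    (heq : ∀ φ : E → ℝ, ContDiff ℝ ∞ φ → HasCompactSupport φ →
      (∫ x, inner ℝ (Du x) (gradient φ x)) + ∫ x, u x * φ x = ∫ x, choquardTerm α p u x * φ x)
    (i : Fin N) {ξ : E → ℝ} (hξ : ContDiff ℝ ∞ ξ) (hc : HasCompactSupport ξ) :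
    p * ((∫ x, Du x i * inner ℝ (Du x) (gradient ξ x)) -
      2⁻¹ * (∫ x, ‖Du x‖ ^ 2 * fderiv ℝ ξ x (EuclideanSpace.single i 1)) -
      2⁻¹ * ∫ x, u x ^ 2 * fderiv ℝ ξ x (EuclideanSpace.single i 1)) =
    - (rieszConst N α * ∫ z : E × E, ‖z.1 - z.2‖ ^ (-((N : ℝ) - α)) *
        (|u z.2| ^ p * |u z.1| ^ p * dilationWeight (N - α) 0 i ξ z)) := by
  have hDuL := memLpLoc_of_memLp hDu2
  have hξH : ∀ j, MemLp (fun x => ξ x • H j x) 2 := fun j => (hH2 j).memLp_smul hξ.continuous hc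
  have hDξ : MemLp (fun x => Du x i • gradient ξ x) 2 :=
    (hDuL.coord i).memLp_smul' (continuous_gradient hξ) (hasCompactSupport_gradient hc)
  have htest := integral_test hN hα hαN hp hu hu2 hDu2 heq ((hH i).smul hξ) hc.mul_right
    ((hDuq.coord i).memLp_smul hξ.continuous hc) ((hDuL.coord i).memLp_smul hξ.continuous hc)
    ((hξH i).add hDξ)
  have hriesz := integral_riesz_mul_gradient hN hα hαN hp hu hDu hDuq i hξ hc
  have h1 : ∫ x, inner ℝ (Du x) (ξ x • H i x + Du x i • gradient ξ x) =
      (∫ x, inner ℝ (Du x) (ξ x • H i x)) + ∫ x, Du x i * inner ℝ (Du x) (gradient ξ x) := by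
    simp_rw [inner_add_right]
    rw [integral_add (integrable_inner_of_memLp hDu2 (hξH i)) (integrable_inner_of_memLp hDu2 hDξ)]
    simp_rw [inner_smul_right]
  have hint : ∀ j, Integrable fun x => Du x j * H j x i * ξ x := fun j => by
    have a1 : MemLp (fun x => Du x j) 2 := (EuclideanSpace.proj (𝕜 := ℝ) j).comp_memLp' hDu2
    have a2 : MemLp (fun x => (ξ x • H j x) i) 2 :=
      (EuclideanSpace.proj (𝕜 := ℝ) i).comp_memLp' (hξH j)
    refine (a1.integrable_mul a2).congr (ae_of_all _ fun x => ?_)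
    simp only [Pi.mul_apply, PiLp.smul_apply, smul_eq_mul]; ring
  have hint2 : ∀ j, Integrable fun x => Du x j ^ 2 * fderiv ℝ ξ x (EuclideanSpace.single i 1) :=
    fun j => by
    have a1 : MemLp (fun x => Du x j) 2 := (EuclideanSpace.proj (𝕜 := ℝ) j).comp_memLp' hDu2
    obtain ⟨C, hC⟩ := (continuous_fderiv_apply_const hξ
      (EuclideanSpace.single i 1)).bounded_above_of_compact_support
      (hasCompactSupport_fderiv_apply hc _)
    exact a1.integrable_sq.mul_bdd
      (continuous_fderiv_apply_const hξ _).aestronglyMeasurable (ae_of_all _ hC)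
  have h2 : ∫ x, inner ℝ (Du x) (ξ x • H i x) =
      -(2⁻¹ * ∫ x, ‖Du x‖ ^ 2 * fderiv ℝ ξ x (EuclideanSpace.single i 1)) := by
    calc _ = ∫ x, ∑ j, Du x j * H j x i * ξ x := by
          refine integral_congr_ae ?_
          -- Symmetry of the weak Hessian turns ∂ⱼ∂ᵢu into ∂ᵢ∂ⱼu, so each summand has the form w ∂ᵢw
          -- with w = ∂ⱼu.
          filter_upwards [ae_all_iff.2 fun j => ae_eq_second_weak_derivatives hDu hH i j] with x hx
          rw [PiLp.inner_apply]
          refine Finset.sum_congr rfl fun j _ => ?_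
          rw [← hx j]; simp; ring
      _ = ∑ j, -(2⁻¹ * ∫ x, Du x j ^ 2 * fderiv ℝ ξ x (EuclideanSpace.single i 1)) := by
          rw [integral_finsetSum _ fun j _ => hint j]
          exact Finset.sum_congr rfl fun j _ =>
            integral_mul_weak_derivative (hH j) (hDuL.coord j) (hH2 j) i hξ hc
      _ = _ := by
          rw [Finset.sum_neg_distrib, ← Finset.mul_sum, ← integral_finsetSum _ fun j _ => hint2 j]
          simp_rw [← Finset.sum_mul, EuclideanSpace.real_norm_sq_eq]
  have h3 : ∫ x, u x * (ξ x * Du x i) =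
      -(2⁻¹ * ∫ x, u x ^ 2 * fderiv ℝ ξ x (EuclideanSpace.single i 1)) := by
    rw [← integral_mul_weak_derivative hDu (memLpLoc_of_memLp hu2) hDuL i hξ hc]
    congr 1; ext x; ring
  rw [h1, h2, h3] at htest
  linear_combination p * htest + rieszConst N α * hriesz

/-! ### Limits along the dilated functions t⁻¹ξ(t·) -/

section Dilation

variable {ξ : EuclideanSpace ℝ (Fin N) → ℝ} {t : ℕ → ℝ}

lemma fderiv_dilate (hξ : ContDiff ℝ ∞ ξ) {s : ℝ} (hs : 0 < s) (x : E) :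
    fderiv ℝ (fun x => s⁻¹ * ξ (s • x)) x = fderiv ℝ ξ (s • x) := by
  rw [fderiv_const_mul, fderiv_comp_smul]
  · simp [smul_smul, hs.ne']
  · exact (hξ.differentiable (by simp)).comp (differentiable_id.const_smul s) _

lemma contDiff_dilate (hξ : ContDiff ℝ ∞ ξ) (s : ℝ) : ContDiff ℝ ∞ fun x => s⁻¹ * ξ (s • x) :=
  contDiff_const.mul (hξ.comp (contDiff_id.const_smul s))

lemma hasCompactSupport_dilate (hc : HasCompactSupport ξ) {s : ℝ} (hs : 0 < s) :
    HasCompactSupport fun x => s⁻¹ * ξ (s • x) :=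
  (hc.comp_smul hs.ne').mul_left

lemma gradient_dilate (hξ : ContDiff ℝ ∞ ξ) {s : ℝ} (hs : 0 < s) (x : E) :
    gradient (fun x => s⁻¹ * ξ (s • x)) x = gradient ξ (s • x) := by
  rw [gradient, gradient, fderiv_dilate hξ hs]

lemma tendsto_gradient_dilate (hξ : ContDiff ℝ ∞ ξ) (ht : ∀ n, 0 < t n)
    (ht0 : Tendsto t atTop (𝓝 0)) (x : E) :
    Tendsto (fun n => gradient (fun x => (t n)⁻¹ * ξ (t n • x)) x) atTop (𝓝 (gradient ξ 0)) := by
  simp_rw [fun n => gradient_dilate hξ (ht n)]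
  refine ((continuous_gradient hξ).tendsto 0).comp ?_
  simpa using ht0.smul_const x

lemma tendsto_integral_mul_fderiv_dilate (hξ : ContDiff ℝ ∞ ξ) (hc : HasCompactSupport ξ)
    (ht : ∀ n, 0 < t n) (ht0 : Tendsto t atTop (𝓝 0)) {h : E → ℝ} (hh : Integrable h)
    (i : Fin N) :
    Tendsto (fun n => ∫ x, h x * fderiv ℝ (fun x => (t n)⁻¹ * ξ (t n • x)) x
      (EuclideanSpace.single i 1)) atTop (𝓝 (∫ x, h x * gradient ξ 0 i)) := by
  obtain ⟨C, hC⟩ := (continuous_fderiv_apply_const hξ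
      (EuclideanSpace.single i 1)).bounded_above_of_compact_support
      (hasCompactSupport_fderiv_apply hc _)
  refine tendsto_integral_of_dominated_convergence (fun x => ‖h x‖ * C) (fun n => ?_)
    (hh.norm.mul_const C) (fun n => ae_of_all _ fun x => ?_) (ae_of_all _ fun x => ?_)
  · exact hh.1.mul (continuous_fderiv_apply_const (contDiff_dilate hξ _) _).aestronglyMeasurable
  · rw [norm_mul, fderiv_dilate hξ (ht n)]
    gcongr; exact hC _
  · simp_rw [← gradient_apply_eq_fderiv]
    exact (((EuclideanSpace.proj (𝕜 := ℝ) i).continuous.tendsto _).comp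
      (tendsto_gradient_dilate hξ ht ht0 x)).const_mul _

lemma tendsto_integral_mul_inner_dilate (hξ : ContDiff ℝ ∞ ξ) (hc : HasCompactSupport ξ)
    (ht : ∀ n, 0 < t n) (ht0 : Tendsto t atTop (𝓝 0)) {h : E → ℝ} {G : E → E}
    (hh : MemLp h 2) (hG : MemLp G 2) :
    Tendsto (fun n => ∫ x, h x * inner ℝ (G x) (gradient (fun x => (t n)⁻¹ * ξ (t n • x)) x))
      atTop (𝓝 (∫ x, h x * inner ℝ (G x) (gradient ξ 0))) := by
  obtain ⟨C, hC⟩ := (continuous_gradient hξ).bounded_above_of_compact_support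
    (hasCompactSupport_gradient hc)
  refine tendsto_integral_of_dominated_convergence (fun x => ‖h x‖ * ‖G x‖ * C) (fun n => ?_)
    ((hh.norm.integrable_mul hG.norm).mul_const C) (fun n => ae_of_all _ fun x => ?_)
    (ae_of_all _ fun x => ?_)
  · exact hh.1.mul (hG.1.inner (continuous_gradient (contDiff_dilate hξ _)).aestronglyMeasurable)
  · rw [norm_mul, mul_assoc]
    gcongr
    refine (norm_inner_le_norm _ _).trans ?_
    rw [gradient_dilate hξ (ht n)]
    gcongr; exact hC _
  · exact (tendsto_const_nhds.inner (tendsto_gradient_dilate hξ ht ht0 x)).const_mul _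

end Dilation

/-- A smooth compactly supported function that agrees with the `i`-th coordinate near `0`. -/
lemma exists_local_coordinate (i : Fin N) :
    ∃ ξ : E → ℝ, ContDiff ℝ ∞ ξ ∧ HasCompactSupport ξ ∧ ξ =ᶠ[𝓝 0] (fun x => x i) ∧
      gradient ξ 0 = EuclideanSpace.single i 1 := by
  obtain ⟨χ, hχ, hχc, hχ1⟩ := exists_cutoff (N := N) (isCompact_singleton (x := 0))
  have hev : (fun x : E => x i * χ x) =ᶠ[𝓝 0] fun x => x i := by
    filter_upwards [hχ1 0 rfl] with x hx
    rw [hx]; simp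
  refine ⟨fun x => x i * χ x, ?_, hχc.mul_left, hev, ?_⟩
  · exact (EuclideanSpace.proj (𝕜 := ℝ) i).contDiff.mul hχ
  · ext j
    rw [gradient_apply_eq_fderiv, hev.fderiv_eq]
    have : fderiv ℝ (fun x : E => x i) 0 = EuclideanSpace.proj (𝕜 := ℝ) i :=
      (EuclideanSpace.proj (𝕜 := ℝ) i).fderiv
    rw [this]
    simp [eq_comm]

/-- With ξ equal to the i-th coordinate near 0, the functions t⁻¹ξ(t·) converge pointwise to xᵢ and
their gradients boundedly to the i-th basis vector, so the local identity passes to the limit as if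
ξ were xᵢ itself. -/
lemma pohozaev_coordinate (hN : 1 ≤ N) (hα : 0 < α) (hαN : α < N) (hp : 1 < p)
    {u : E → ℝ} {Du : E → E} {H : Fin N → E → E}
    (hu : MemLp u (ENNReal.ofReal (2 * N / (N + α) * p)))
    (hu2 : MemLp u 2) (hDu2 : MemLp Du 2) (hDu : HasWeakGradient u Du)
    (hDuq : MemLpLoc Du (ENNReal.ofReal (2 * N / (N + α) * p)))
    (hH : ∀ i, HasWeakGradient (fun x => Du x i) (H i)) (hH2 : ∀ i, MemLpLoc (H i) 2)
    (heq : ∀ φ : E → ℝ, ContDiff ℝ ∞ φ → HasCompactSupport φ →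
      (∫ x, inner ℝ (Du x) (gradient φ x)) + ∫ x, u x * φ x = ∫ x, choquardTerm α p u x * φ x)
    (i : Fin N) :
    Integrable (fun z : E × E => ‖z.1 - z.2‖ ^ (-((N : ℝ) - α)) * (|u z.2| ^ p * |u z.1| ^ p *
        (1 - ((N : ℝ) - α) / 2 * ((z.1 - z.2) i ^ 2 / ‖z.1 - z.2‖ ^ 2)))) ∧
    p * ((∫ x, Du x i ^ 2) - 2⁻¹ * (∫ x, ‖Du x‖ ^ 2) - 2⁻¹ * ∫ x, u x ^ 2) =
    - (rieszConst N α * ∫ z : E × E, ‖z.1 - z.2‖ ^ (-((N : ℝ) - α)) *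
        (|u z.2| ^ p * |u z.1| ^ p *
          (1 - ((N : ℝ) - α) / 2 * ((z.1 - z.2) i ^ 2 / ‖z.1 - z.2‖ ^ 2)))) := by
  have hN0 : (0 : ℝ) < N := by exact_mod_cast hN
  have hr : 0 < 2 * N / (N + α) := by positivity
  have hs : 0 < (N : ℝ) - α := by linarith
  obtain ⟨ξ, hξ, hc, hξ0, hξg⟩ := exists_local_coordinate i
  let t : ℕ → ℝ := fun n => 1 / ((n : ℝ) + 1)
  have ht : ∀ n, 0 < t n := fun n => by positivity
  have ht0 : Tendsto t atTop (𝓝 0) := tendsto_one_div_add_atTop_nhds_zero_nat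
  have key := fun n => pohozaev_local hN hα hαN hp hu hu2 hDu2 hDu hDuq hH hH2 heq i
    (contDiff_dilate hξ (t n)) (hasCompactSupport_dilate hc (ht n))
  have a1 : MemLp (fun x => Du x i) 2 := (EuclideanSpace.proj (𝕜 := ℝ) i).comp_memLp' hDu2
  have lim1 := tendsto_integral_mul_inner_dilate hξ hc ht ht0 a1 hDu2
  have lim2 := tendsto_integral_mul_fderiv_dilate hξ hc ht ht0
    ((memLp_two_iff_integrable_sq_norm hDu2.1).1 hDu2) i
  have lim3 := tendsto_integral_mul_fderiv_dilate hξ hc ht ht0 hu2.integrable_sq i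
  simp only [hξg, EuclideanSpace.inner_single_right, PiLp.single_apply, if_true, mul_one,
    one_mul, conj_trivial, ← pow_two] at lim1 lim2 lim3
  obtain ⟨C, hC⟩ := exists_dilationWeight_bound hξ hc hs.le i
  have hfp : MemLp (fun x => |u x| ^ p) (ENNReal.ofReal (2 * N / (N + α))) :=
    memLp_abs_rpow (by linarith) hr hu
  have hI := integrable_prod_riesz hN hα hαN hp hu hfp
  have hu2' := hfp.1.comp_quasiMeasurePreserving
    (Measure.quasiMeasurePreserving_snd (μ := (volume : Measure E)) (ν := (volume : Measure E)))
  have hu1' := hfp.1.comp_quasiMeasurePreserving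
    (Measure.quasiMeasurePreserving_fst (μ := (volume : Measure E)) (ν := (volume : Measure E)))
  have hkm : AEStronglyMeasurable (fun z : E × E => ‖z.1 - z.2‖ ^ (-((N : ℝ) - α))) volume := by
    have : Measurable fun z : E × E => ‖z.1 - z.2‖ ^ (-((N : ℝ) - α)) := by fun_prop
    exact this.aestronglyMeasurable
  have hF : ∀ n, AEStronglyMeasurable (fun z : E × E => ‖z.1 - z.2‖ ^ (-((N : ℝ) - α)) *
        (|u z.2| ^ p * |u z.1| ^ p *
          dilationWeight (N - α) 0 i (fun x => (t n)⁻¹ * ξ (t n • x)) z)) volume := fun n =>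
    hkm.mul ((hu2'.mul hu1').mul
      (measurable_dilationWeight (contDiff_dilate hξ _) _ _ _).aestronglyMeasurable)
  have hFb : ∀ n (z : E × E), ‖‖z.1 - z.2‖ ^ (-((N : ℝ) - α)) *
        (|u z.2| ^ p * |u z.1| ^ p *
          dilationWeight (N - α) 0 i (fun x => (t n)⁻¹ * ξ (t n • x)) z)‖ ≤
      ‖‖z.1 - z.2‖ ^ (-((N : ℝ) - α)) * (|u z.2| ^ p * |u z.1| ^ p)‖ * C := fun n z => by
    rw [← mul_assoc, norm_mul]
    gcongr
    exact hC _ _ _ (ht n)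
  have hFl : ∀ z : E × E, Tendsto (fun n => ‖z.1 - z.2‖ ^ (-((N : ℝ) - α)) *
        (|u z.2| ^ p * |u z.1| ^ p *
          dilationWeight (N - α) 0 i (fun x => (t n)⁻¹ * ξ (t n • x)) z)) atTop
      (𝓝 (‖z.1 - z.2‖ ^ (-((N : ℝ) - α)) * (|u z.2| ^ p * |u z.1| ^ p *
        (1 - ((N : ℝ) - α) / 2 * ((z.1 - z.2) i ^ 2 / ‖z.1 - z.2‖ ^ 2))))) := fun z => by
    have hξl : ∀ x : E, Tendsto (fun n => (t n)⁻¹ * ξ (t n • x)) atTop (𝓝 (x i)) := fun x => by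
      have : Tendsto (fun n => t n • x) atTop (𝓝 0) := by simpa using ht0.smul_const x
      -- For fixed x the sequence is eventually constant: t n • x enters the neighbourhood where ξ
      -- is the coordinate, and the factors of t cancel.
      refine tendsto_const_nhds.congr' ?_
      filter_upwards [this.eventually hξ0] with n hn
      rw [hn, PiLp.smul_apply, smul_eq_mul, inv_mul_cancel_left₀ (ht n).ne']
    refine ((Tendsto.sub ?_ (Tendsto.const_mul _ ?_)).const_mul _).const_mul _
    · have := ((EuclideanSpace.proj (𝕜 := ℝ) i).continuous.tendsto _).comp
        (tendsto_gradient_dilate hξ ht ht0 z.1)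
      rw [hξg] at this
      simpa [Function.comp_def, gradient_apply_eq_fderiv] using this
    · have := (((hξl z.1).sub (hξl z.2)).const_mul ((z.1 - z.2) i)).div_const
        (‖z.1 - z.2‖ ^ 2 + 0 ^ 2)
      convert this using 2
      simp [pow_two]
  have lim4 := tendsto_integral_of_dominated_convergence _ hF (hI.norm.mul_const C)
    (fun n => ae_of_all _ (hFb n)) (ae_of_all _ hFl)
  refine ⟨?_, ?_⟩
  · refine (hI.norm.mul_const C).mono' (aestronglyMeasurable_of_tendsto_ae atTop hF (ae_of_all _ hFl))
      (ae_of_all _ fun z => ?_)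
    exact le_of_tendsto (hFl z).norm (Eventually.of_forall fun n => hFb n z)
  · exact tendsto_nhds_unique
      ((((lim1.sub (lim2.const_mul _)).sub (lim3.const_mul _)).const_mul p).congr key)
      (lim4.const_mul _).neg

/-- The Pohozaev identity for the Choquard equation. -/
lemma pohozaev (hN : 1 ≤ N) (hα : 0 < α) (hαN : α < N) (hp : 1 < p)
    {u : E → ℝ} {Du : E → E} {H : Fin N → E → E}
    (hu : MemLp u (ENNReal.ofReal (2 * N / (N + α) * p)))
    (hu2 : MemLp u 2) (hDu2 : MemLp Du 2) (hDu : HasWeakGradient u Du)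
    (hDuq : MemLpLoc Du (ENNReal.ofReal (2 * N / (N + α) * p)))
    (hH : ∀ i, HasWeakGradient (fun x => Du x i) (H i)) (hH2 : ∀ i, MemLpLoc (H i) 2)
    (heq : ∀ φ : E → ℝ, ContDiff ℝ ∞ φ → HasCompactSupport φ →
      (∫ x, inner ℝ (Du x) (gradient φ x)) + ∫ x, u x * φ x = ∫ x, choquardTerm α p u x * φ x) :
    p * (((N : ℝ) - 2) * (∫ x, ‖Du x‖ ^ 2) + N * ∫ x, u x ^ 2) =
      (N + α) * (rieszConst N α * ∫ z : E × E, ‖z.1 - z.2‖ ^ (-((N : ℝ) - α)) *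
        (|u z.2| ^ p * |u z.1| ^ p)) := by
  have h := fun i => pohozaev_coordinate hN hα hαN hp hu hu2 hDu2 hDu hDuq hH hH2 heq i
  have hsum := Finset.sum_congr (rfl : (Finset.univ : Finset (Fin N)) = Finset.univ)
    fun i _ => (h i).2
  have a1 : ∀ i : Fin N, MemLp (fun x => Du x i) 2 := fun i =>
    (EuclideanSpace.proj (𝕜 := ℝ) i).comp_memLp' hDu2
  have s1 : ∑ i, ∫ x, Du x i ^ 2 = ∫ x, ‖Du x‖ ^ 2 := by
    rw [← integral_finsetSum _ fun i _ => (a1 i).integrable_sq]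
    simp_rw [EuclideanSpace.real_norm_sq_eq]
  have s2 : ∑ i : Fin N, ∫ z : E × E, ‖z.1 - z.2‖ ^ (-((N : ℝ) - α)) *
        (|u z.2| ^ p * |u z.1| ^ p *
          (1 - ((N : ℝ) - α) / 2 * ((z.1 - z.2) i ^ 2 / ‖z.1 - z.2‖ ^ 2))) =
      ((N : ℝ) - (N - α) / 2) * ∫ z : E × E, ‖z.1 - z.2‖ ^ (-((N : ℝ) - α)) *
        (|u z.2| ^ p * |u z.1| ^ p) := by
    rw [← integral_finsetSum _ fun i _ => (h i).1, ← integral_const_mul]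
    refine integral_congr_ae ?_
    filter_upwards [ae_prod_ne hN] with z hz
    have hz : ‖z.1 - z.2‖ ^ 2 ≠ 0 := pow_ne_zero _ (norm_ne_zero_iff.2 hz)
    -- The squared coordinates of the unit vector (x - y)/|x - y| sum to 1, so the weights add up to
    -- N - (N-α)/2 = (N+α)/2.
    rw [← Finset.mul_sum, ← Finset.mul_sum, Finset.sum_sub_distrib, ← Finset.mul_sum,
      ← Finset.sum_div, ← EuclideanSpace.real_norm_sq_eq, div_self hz]
    simp; ring
  rw [← Finset.mul_sum, Finset.sum_neg_distrib, ← Finset.mul_sum, s2, Finset.sum_sub_distrib,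
    Finset.sum_sub_distrib, s1] at hsum
  simp only [Finset.sum_const, Finset.card_univ, Fintype.card_fin, nsmul_eq_mul] at hsum
  linear_combination (-2) * hsum

/-- The identity obtained by testing the Choquard equation with the solution itself. -/
lemma nehari (hN : 1 ≤ N) (hα : 0 < α) (hαN : α < N) (hp : 1 < p)
    {u : E → ℝ} {Du : E → E} (hu : MemLp u (ENNReal.ofReal (2 * N / (N + α) * p)))
    (hu2 : MemLp u 2) (hDu2 : MemLp Du 2) (hDu : HasWeakGradient u Du)
    (heq : ∀ φ : E → ℝ, ContDiff ℝ ∞ φ → HasCompactSupport φ →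
      (∫ x, inner ℝ (Du x) (gradient φ x)) + ∫ x, u x * φ x = ∫ x, choquardTerm α p u x * φ x) :
    (∫ x, ‖Du x‖ ^ 2) + ∫ x, u x ^ 2 = rieszConst N α *
      ∫ z : E × E, ‖z.1 - z.2‖ ^ (-((N : ℝ) - α)) * (|u z.2| ^ p * |u z.1| ^ p) := by
  have hN0 : (0 : ℝ) < N := by exact_mod_cast hN
  have hr : 0 < 2 * N / (N + α) := by positivity
  obtain ⟨χ, hχ, hχc, hχ1⟩ := exists_cutoff (N := N) (isCompact_singleton (x := 0))
  have hχ0 : χ 0 = 1 := (hχ1 0 rfl).eq_of_nhds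
  let t : ℕ → ℝ := fun n => 1 / ((n : ℝ) + 1)
  have ht : ∀ n, 0 < t n := fun n => by positivity
  have ht0 : Tendsto t atTop (𝓝 0) := tendsto_one_div_add_atTop_nhds_zero_nat
  have htx : ∀ x : E, Tendsto (fun n => t n • x) atTop (𝓝 0) := fun x => by
    simpa using ht0.smul_const x
  -- The product η n · u is compactly supported, hence admissible in `integral_test`. The gradient
  -- of η n carries a factor t n, so the cross term vanishes in the limit.
  let η : ℕ → E → ℝ := fun n x => χ (t n • x)
  have hη : ∀ n, ContDiff ℝ ∞ (η n) := fun n => hχ.comp (contDiff_id.const_smul (t n))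
  have hηc : ∀ n, HasCompactSupport (η n) := fun n => hχc.comp_smul (ht n).ne'
  have hηl : ∀ x, Tendsto (fun n => η n x) atTop (𝓝 1) := fun x => by
    rw [← hχ0]; exact (hχ.continuous.tendsto 0).comp (htx x)
  have hηg : ∀ n x, gradient (η n) x = t n • gradient χ (t n • x) := fun n x => by
    rw [gradient, gradient, fderiv_comp_smul, map_smul]
  obtain ⟨C, hC⟩ := hχ.continuous.bounded_above_of_compact_support hχc
  have hDuL := memLpLoc_of_memLp hDu2
  have huL := memLpLoc_of_memLp hu2
  have m1 : ∀ n, MemLp (fun x => η n x • Du x) 2 := fun n => hDuL.memLp_smul (hη n).continuous (hηc n)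
  have m2 : ∀ n, MemLp (fun x => u x • gradient (η n) x) 2 := fun n =>
    huL.memLp_smul' (continuous_gradient (hη n)) (hasCompactSupport_gradient (hηc n))
  have huη : ∀ n, MemLp (fun x => η n x * u x) (ENNReal.ofReal (2 * N / (N + α) * p)) := fun n =>
    (memLpLoc_of_memLp hu).memLp_smul (hη n).continuous (hηc n)
  have key := fun n => integral_test hN hα hαN hp hu hu2 hDu2 heq (hDu.smul (hη n))
    (hηc n).mul_right (huη n) (huL.memLp_smul (hη n).continuous (hηc n)) ((m1 n).add (m2 n))
  have split : ∀ n, ∫ x, inner ℝ (Du x) (η n x • Du x + u x • gradient (η n) x) =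
      (∫ x, η n x * ‖Du x‖ ^ 2) + t n * ∫ x, u x * inner ℝ (Du x) (gradient χ (t n • x)) := fun n => by
    simp_rw [inner_add_right]
    rw [integral_add (integrable_inner_of_memLp hDu2 (m1 n)) (integrable_inner_of_memLp hDu2 (m2 n)),
      ← integral_const_mul]
    congr 1
    · simp_rw [inner_smul_right, real_inner_self_eq_norm_sq]
    · congr 1; ext x; rw [hηg, inner_smul_right, inner_smul_right]; ring
  simp_rw [split] at key
  -- Stated for a general measure space so that it covers both the integrals over ℝ^N and, with π
  -- the first projection, the double integral.
  have lim : ∀ {X : Type} [MeasurableSpace X] (μ : Measure X) (f : X → ℝ) (π : X → E),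
      Measurable π → Integrable f μ →
      Tendsto (fun n => ∫ x, η n (π x) * f x ∂μ) atTop (𝓝 (∫ x, f x ∂μ)) := by
    intro X _ μ f π hπ hf
    refine tendsto_integral_of_dominated_convergence (fun x => C * ‖f x‖) (fun n => ?_)
      (hf.norm.const_mul C) (fun n => ae_of_all _ fun x => ?_) (ae_of_all _ fun x => ?_)
    · exact ((hη n).continuous.measurable.comp hπ).aestronglyMeasurable.mul hf.1
    · rw [norm_mul]; gcongr; exact hC _
    · simpa using (hηl (π x)).mul_const (f x)
  have lim1 := lim volume _ id measurable_id ((memLp_two_iff_integrable_sq_norm hDu2.1).1 hDu2)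
  have lim2 := tendsto_integral_mul_inner_dilate hχ hχc ht ht0 hu2 hDu2
  simp_rw [fun n => gradient_dilate hχ (ht n)] at lim2
  have lim3 := lim volume _ id measurable_id hu2.integrable_sq
  have hfp : MemLp (fun x => |u x| ^ p) (ENNReal.ofReal (2 * N / (N + α))) :=
    memLp_abs_rpow (by linarith) hr hu
  have lim4 := lim volume _ Prod.fst measurable_fst (integrable_prod_riesz hN hα hαN hp hu hfp)
  have hlhs := (lim1.add (ht0.mul lim2)).add lim3
  rw [zero_mul, add_zero] at hlhs
  refine tendsto_nhds_unique hlhs ((lim4.const_mul _).congr fun n => ?_)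
  have e1 : ∫ x, u x * (η n x * u x) = ∫ x, η n (id x) * u x ^ 2 := by
    congr 1; ext x; simp only [id]; ring
  have hself : ∀ s : ℝ, |s| ^ (p - 2) * s * s = |s| ^ p := fun s => by
    rcases eq_or_ne s 0 with rfl | hs
    · rw [mul_zero, abs_zero, Real.zero_rpow (by linarith)]
    · rw [mul_assoc, ← pow_two, ← sq_abs, ← Real.rpow_natCast, ← Real.rpow_add (abs_pos.2 hs)]
      congr 1; push_cast; ring
  have e2 : ∫ z : E × E, ‖z.1 - z.2‖ ^ (-((N : ℝ) - α)) *
        (|u z.2| ^ p * (|u z.1| ^ (p - 2) * u z.1 * (η n z.1 * u z.1))) =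
      ∫ z : E × E, η n z.1 * (‖z.1 - z.2‖ ^ (-((N : ℝ) - α)) * (|u z.2| ^ p * |u z.1| ^ p)) := by
    congr 1; ext z; rw [← hself (u z.1)]; ring
  rw [← e2, ← key n, e1]
  rfl

/-- Since u ∂ᵢu = 0, the integral of u² ∂ᵢξ vanishes for each compactly supported smooth ξ. Along
dilated local coordinates ∂ᵢξ tends boundedly to 1, which leaves ∫u² = 0 without first showing that
u is constant. -/
lemma integral_sq_eq_zero_of_weak_gradient_eq_zero (hN : 1 ≤ N) {u : E → ℝ} {Du : E → E}
    (hu2 : MemLp u 2) (hDu : HasWeakGradient u Du) (h0 : Du =ᵐ[volume] 0) :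
    ∫ x, u x ^ 2 = 0 := by
  let i : Fin N := ⟨0, hN⟩
  obtain ⟨ξ, hξ, hc, -, hξg⟩ := exists_local_coordinate i
  let t : ℕ → ℝ := fun n => 1 / ((n : ℝ) + 1)
  have ht : ∀ n, 0 < t n := fun n => by positivity
  have ht0 : Tendsto t atTop (𝓝 0) := tendsto_one_div_add_atTop_nhds_zero_nat
  have hDu2 : MemLp Du 2 := (memLp_congr_ae h0).2 MemLp.zero
  have lim := tendsto_integral_mul_fderiv_dilate hξ hc ht ht0 hu2.integrable_sq i
  simp only [hξg, PiLp.single_apply, if_true, mul_one] at lim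
  refine tendsto_nhds_unique lim (tendsto_const_nhds.congr fun n => ?_)
  have h1 := integral_mul_weak_derivative hDu (memLpLoc_of_memLp hu2) (memLpLoc_of_memLp hDu2) i
    (contDiff_dilate hξ (t n)) (hasCompactSupport_dilate hc (ht n))
  have h2 : ∫ x, u x * Du x i * ((t n)⁻¹ * ξ (t n • x)) = 0 := by
    rw [← integral_zero E ℝ]
    refine integral_congr_ae ?_
    filter_upwards [h0] with x hx
    simp [hx]
  linarith

end Pohozaev

end Choquard

/-! ### Conclusion: combining the two identities -/

theorem theorem2 (N : ℕ) (hN : 1 ≤ N) (α p : ℝ) (hα : 0 < α) (hαN : α < N) (hp : 1 < p)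
    (u : EuclideanSpace ℝ (Fin N) → ℝ)
    (hu : Choquard.MemW12 u)
    (huq : MeasureTheory.MemLp u (ENNReal.ofReal (2 * N * p / (N + α))))
    (Du : EuclideanSpace ℝ (Fin N) → EuclideanSpace ℝ (Fin N))
    (hDu : Choquard.HasWeakGradient u Du)
    (hDu_loc : ∀ i : Fin N, Choquard.MemW12Loc (fun x => Du x i))
    (hDuq_loc : Choquard.MemLpLoc Du (ENNReal.ofReal (2 * N * p / (N + α))))
    (hrange : 1 / p ≤ ((N : ℝ) - 2) / (N + α) ∨ (N : ℝ) / (N + α) ≤ 1 / p)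
    (hsol : Choquard.IsWeakSolution α p u) :
    u =ᵐ[MeasureTheory.volume] 0 := by
  open Choquard MeasureTheory in
  have hN0 : (0 : ℝ) < N := by exact_mod_cast hN
  have hNα : (0 : ℝ) < N + α := by linarith
  have hexp : 2 * N * p / (N + α) = 2 * N / (N + α) * p := by ring
  rw [hexp] at huq hDuq_loc
  obtain ⟨hu2, G, hG, hG2⟩ := hu
  have hDu2 : MemLp Du 2 := (memLp_congr_ae (hDu.ae_eq hG)).2 hG2
  obtain ⟨G', hG', hsol⟩ := hsol
  have heq : ∀ φ : EuclideanSpace ℝ (Fin N) → ℝ, ContDiff ℝ (⊤ : ℕ∞) φ → HasCompactSupport φ →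
      (∫ x, inner ℝ (Du x) (gradient φ x)) + ∫ x, u x * φ x =
        ∫ x, choquardTerm α p u x * φ x := fun φ hφ hc => by
    rw [← hsol φ hφ hc]
    congr 1
    refine integral_congr_ae ?_
    filter_upwards [hDu.ae_eq hG'] with x hx
    rw [hx]
  choose hDuL H hH hH2 using hDu_loc
  have hpoh := pohozaev hN hα hαN hp huq hu2 hDu2 hDu hDuq_loc hH hH2 heq
  have hneh := nehari hN hα hαN hp huq hu2 hDu2 hDu heq
  rw [← hneh] at hpoh
  set A := ∫ x, ‖Du x‖ ^ 2 with hA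
  set B := ∫ x, u x ^ 2 with hB
  have hA0 : 0 ≤ A := integral_nonneg fun x => by positivity
  have hB0 : 0 ≤ B := integral_nonneg fun x => by positivity
  have hBz : B = 0 := by
    rcases hrange with h | h
    · rw [div_le_div_iff₀ (by linarith) hNα] at h
      -- The combined identity reads 2pB = -(p(N-2) - (N+α))(A + B), whose right side is
      -- nonpositive.
      nlinarith [mul_nonneg (sub_nonneg.2 h) (add_nonneg hA0 hB0)]
    · rw [div_le_div_iff₀ hNα (by linarith)] at h
      -- Here the identity is used as 2pA = (pN - (N+α))(A + B) ≤ 0.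
      have hAz : A = 0 := by
        nlinarith [mul_nonneg (sub_nonneg.2 h) (add_nonneg hA0 hB0)]
      refine integral_sq_eq_zero_of_weak_gradient_eq_zero hN hu2 hDu ?_
      have := (integral_eq_zero_iff_of_nonneg (fun x => by positivity)
        ((memLp_two_iff_integrable_sq_norm hDu2.1).1 hDu2)).1 hAz
      filter_upwards [this] with x hx
      simpa using hx
  have := (integral_eq_zero_iff_of_nonneg (fun x => by positivity) hu2.integrable_sq).1 hBz
  filter_upwards [this] with x hx
  simpa using hx
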